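/- Let $w=(w_z)_{z\in\mathbb Z}$ be a stationary process of non-negative (not necessarily strictly positive) random variables, where $w_z=w_{\langle z,z+1\rangle}=w_{\langle z+1,z\rangle}$ is the symmetric jump rate across the bond $\langle z,z+1\rangle$ of $\mathbb Z$. Suppose that for some constant $0<\kappa<\infty$, almost surely, $$\frac1x\sum_{z=0}^{x-1}\frac1{w_z}\longrightarrow\kappa^{-1}\qquad(x\to\infty),$$ where $1/0=\infty$. For $L\in\mathbb N$ let $\Lambda_L=\{x\in\mathbb Z:|x|<L\}$, and let $\Delta_{L,w}$ be the generator of the walk on $\Lambda_L$ with absorbing boundary, $$(\Delta_{L,w}u)_x=w_x(u_{x+1}-u_x)+w_{x-1}(u_{x-1}-u_x),\qquad x\in\Lambda_L,\quad u_y=0\text{ for }y\notin\Lambda_L .$$ Let $i_L:\mathbb R^{\Lambda_L}\to L^2(-1,1)$, $(i_Lu)(\xi)=u_{\lfloor L\xi\rfloor}$ (again with $u=0$ off $\Lambda_L$), and $(i_L^\dagger f)_x=L\int_{x/L}^{(x+1)/L}f(r)\,dr$ for $x\in\Lambda_L$. Let $e^{t\kappa\,d^2/dr^2}$, $t>0$,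 be the heat semigroup on $(-1,1)$ with Dirichlet boundary condition, that is, the transition semigroup of the Brownian motion with generator $\kappa\,d^2/dr^2$ absorbed at $\pm1$; it acts on $L^2(-1,1)$ and, through its integral kernel $\sum_{n\ge1}e^{-t\kappa(n\pi/2)^2}e_n(r)e_n(s)$ with $e_n(r)=\sin\bigl(\tfrac{n\pi}2(r+1)\bigr)$, on finite measures on $(-1,1)$. Then for almost every $w$ the diffusively rescaled walk with absorbing boundary converges to Brownian motion on $(-1,1)$ with diffusion coefficient $\kappa$, in both of the following senses, for every $t_0>0$. 1. In the operator norm of $L^2(-1,1)$, $$\lim_{L\to\infty}\ \sup_{t\ge t_0}\bigl\|\,i_L\,e^{tL^2\Delta_{L,w}}\,i_L^\dagger-e^{t\kappa\,d^2/dr^2}\bigr\|=0 .$$ 2. As $L\to\infty$, $$\bigl(e^{L^2t\Delta_{L,w}}u_0\bigr)_{\lfloor L\xi\rfloor}\longrightarrow\bigl(e^{t\kappa\,d^2/dr^2}\mu_0\bigr)(\xi),\qquad (u_0)_x=L\,\mu_0\bigl(\bigl[\tfrac xL,\tfrac{x+1}L\bigr)\bigr)\quad(x\in\Lambda_L),$$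 uniformly in $t\ge t_0$, in $\xi\in(-1,1)$, and in the positive measures $\mu_0$ on $(-1,1)$ of total mass at most $1$ (the left-hand side is $0$ where $\lfloor L\xi\rfloor\notin\Lambda_L$). -/

import Mathlib

open MeasureTheory ProbabilityTheory Filter Topology
open scoped ENNReal NNReal

namespace RandomConductance

/-! ### The random walk on `{-L+1, …, L-1}` with absorbing boundary

An environment on the bonds of `ℤ` is a function `w : ℤ → ℝ≥0`, where `w z` is the (symmetric)
jump rate across the bond `⟨z, z+1⟩`. -/

/-- The box `Λ_L = {x ∈ ℤ : |x| < L}`. -/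
noncomputable abbrev box (L : ℕ) : Finset ℤ := Finset.Ioo (-(L : ℤ)) (L : ℤ)

/-- The extension by zero to `ℤ` of a vector indexed by the box (absorbing boundary). -/
noncomputable def zeroExt {L : ℕ} (u : box L → ℝ) (z : ℤ) : ℝ :=
  if h : z ∈ box L then u ⟨z, h⟩ else 0

/-- The generator `Δ_{L,w}` of the walk on the box with absorbing boundary, as a matrix. -/
noncomputable def generator (L : ℕ) (w : ℤ → ℝ≥0) : Matrix (box L) (box L) ℝ :=
  Matrix.of fun x y =>
    if (y : ℤ) = x + 1 then (w x : ℝ)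
    else if (y : ℤ) = x - 1 then (w (x - 1) : ℝ)
    else if (y : ℤ) = x then -((w x : ℝ) + w (x - 1))
    else 0

/-- The matrix acts as `(Δ_{L,w} u)_x = ∑_{|y-x|=1} w_{⟨xy⟩} (u_y - u_x)` with `u = 0` off the
box. -/
theorem generator_mulVec (L : ℕ) (w : ℤ → ℝ≥0) (u : box L → ℝ) (x : box L) :
    (generator L w).mulVec u x =
      w x * (zeroExt u (x + 1) - u x) + w (x - 1) * (zeroExt u (x - 1) - u x) := by
  have key : ∀ z : ℤ, ∑ y : box L, (if (y : ℤ) = z then u y else 0) = zeroExt u z := by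
    intro z
    unfold zeroExt
    split_ifs with h
    · rw [Finset.sum_eq_single ⟨z, h⟩]
      · simp
      · intro b _ hb
        rw [if_neg (fun hbz => hb (Subtype.ext hbz))]
      · simp
    · exact Finset.sum_eq_zero fun y _ => if_neg fun hy => h (by rw [← hy]; exact y.2)
  have hx : zeroExt u (x : ℤ) = u x := by
    unfold zeroExt
    rw [dif_pos x.2]
  rw [← key, ← key, ← hx, ← key, mul_sub, mul_sub, Finset.mul_sum, Finset.mul_sum, Finset.mul_sum,
    Finset.mul_sum, ← Finset.sum_sub_distrib, ← Finset.sum_sub_distrib, ← Finset.sum_add_distrib]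
  unfold Matrix.mulVec dotProduct generator
  refine Finset.sum_congr rfl fun y _ => ?_
  simp only [Matrix.of_apply]
  by_cases h1 : (y : ℤ) = x + 1
  · simp [h1, show ¬ ((x : ℤ) + 1 = x - 1) by lia]
  by_cases h2 : (y : ℤ) = x - 1
  · simp [h2, show ¬ ((x : ℤ) - 1 = x + 1) by lia]
  by_cases h3 : (y : ℤ) = x
  · simp [h3, show ¬ ((x : ℤ) = x - 1) by lia]
    ring
  · simp [h1, h2, h3]

/-- The sub-Markov transition matrix `exp (s Δ_{L,w})` of the walk at time `s`. -/
noncomputable def transition (L : ℕ) (w : ℤ → ℝ≥0) (s : ℝ) : Matrix (box L) (box L) ℝ :=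
  NormedSpace.exp (s • generator L w)

/-! ### The rescaled semigroup on `L²(-1,1)` -/

/-- Lebesgue measure on the interval `(-1,1)`. -/
noncomputable abbrev intervalMeasure : Measure ℝ := volume.restrict (Set.Ioo (-1) 1)

/-- The real Hilbert space `L²(-1,1)`. -/
abbrev L2I : Type := Lp ℝ 2 intervalMeasure

/-- The cell `[x/L, (x+1)/L)`, that is, the set of `ξ` with `⌊L ξ⌋ = x`. -/
def cell (L : ℕ) (x : ℤ) : Set ℝ := Set.Ico ((x : ℝ) / L) (((x : ℝ) + 1) / L)

theorem measurableSet_cell (L : ℕ) (x : ℤ) : MeasurableSet (cell L x) := measurableSet_Ico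

/-- The indicator function of a cell as an element of `L²(-1,1)`. -/
noncomputable def cellInd (L : ℕ) (x : ℤ) : L2I :=
  indicatorConstLp 2 (measurableSet_cell L x)
    (measure_ne_top intervalMeasure (cell L x)) (1 : ℝ)

/-- `i_L u`, the piecewise constant function `ξ ↦ u_{⌊L ξ⌋}` (with `u = 0` off the box). -/
noncomputable def embed (L : ℕ) : (box L → ℝ) →L[ℝ] L2I :=
  ∑ x : box L, (ContinuousLinearMap.proj (R := ℝ) (φ := fun _ : box L => ℝ) x).smulRight
    (cellInd L x)

/-- `i_L† f`, the vector of cell averages `(i_L† f)_x = L ∫_{x/L}^{(x+1)/L} f`. -/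
noncomputable def average (L : ℕ) : L2I →L[ℝ] (box L → ℝ) :=
  ContinuousLinearMap.pi fun x : box L => (L : ℝ) • innerSL ℝ (cellInd L x)

theorem average_apply (L : ℕ) (f : L2I) (x : box L) :
    average L f x = L * ∫ r in cell L x, f r ∂intervalMeasure := by
  have h : inner ℝ (cellInd L x) f = ∫ r in cell L x, f r ∂intervalMeasure :=
    L2.inner_indicatorConstLp_one _ _ f
  simp [average, h]

/-- The diffusively rescaled semigroup `i_L exp (t L² Δ_{L,w}) i_L†` on `L²(-1,1)`. -/
noncomputable def walkSemigroup (L : ℕ) (w : ℤ → ℝ≥0) (t : ℝ) : L2I →L[ℝ] L2I :=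
  embed L ∘L (Matrix.toLin' (transition L w ((L : ℝ) ^ 2 * t))).toContinuousLinearMap ∘L average L

/-! ### The heat semigroup of `κ d²/dr²` on `(-1,1)` with Dirichlet boundary condition -/

/-- The `n`-th normalized Dirichlet eigenfunction of `d²/dr²` on `(-1,1)`, `n ≥ 1`. Up to the sign
it is `cos (π n r / 2)` for odd `n` and `sin (π n r / 2)` for even `n`. -/
noncomputable def mode (n : ℕ) (r : ℝ) : ℝ := Real.sin (n * Real.pi / 2 * (r + 1))

/-- The `n`-th eigenvalue of `-d²/dr²` on `(-1,1)` with Dirichlet boundary condition. -/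
noncomputable def eigenvalue (n : ℕ) : ℝ := (n * Real.pi / 2) ^ 2

theorem continuous_mode (n : ℕ) : Continuous (mode n) := by
  unfold mode; fun_prop

theorem abs_mode_le (n : ℕ) (r : ℝ) : |mode n r| ≤ 1 := Real.abs_sin_le_one _

theorem memLp_mode (n : ℕ) : MemLp (mode n) 2 intervalMeasure :=
  MemLp.of_bound (continuous_mode n).aestronglyMeasurable 1
    (Eventually.of_forall fun r => by simpa using abs_mode_le n r)

theorem mode_boundary (n : ℕ) : mode n (-1) = 0 ∧ mode n 1 = 0 := by
  refine ⟨by simp [mode], ?_⟩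
  have : (n : ℝ) * Real.pi / 2 * (1 + 1) = n * Real.pi := by ring
  rw [mode, this, Real.sin_nat_mul_pi]

theorem deriv_deriv_mode (n : ℕ) (r : ℝ) :
    deriv (deriv (mode n)) r = -eigenvalue n * mode n r := by
  have h1 : ∀ s, HasDerivAt (fun s : ℝ => (n : ℝ) * Real.pi / 2 * (s + 1)) (n * Real.pi / 2) s := by
    intro s
    simpa using ((hasDerivAt_id s).add_const 1).const_mul ((n : ℝ) * Real.pi / 2)
  have h2 : deriv (mode n) =
      fun s => Real.cos (n * Real.pi / 2 * (s + 1)) * (n * Real.pi / 2) := by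
    funext s
    exact (h1 s).sin.deriv
  rw [h2, ((h1 r).cos.mul_const _).deriv, eigenvalue, mode]
  ring

/-- The `n`-th Dirichlet eigenfunction as an element of `L²(-1,1)`. -/
noncomputable def modeL2 (n : ℕ) : L2I := (memLp_mode n).toLp (mode n)

theorem norm_modeL2_le (n : ℕ) : ‖modeL2 n‖ ≤ 2 := by
  have h := Lp.norm_le_of_ae_bound (p := 2) (μ := intervalMeasure) (f := modeL2 n) zero_le_one
    (by
      filter_upwards [(memLp_mode n).coeFn_toLp] with r hr
      rw [modeL2, hr]
      exact abs_mode_le n r)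
  refine h.trans ?_
  have h2 : (measureUnivNNReal intervalMeasure : ℝ) = 2 := by
    change (intervalMeasure Set.univ).toReal = 2
    norm_num [intervalMeasure]
  rw [h2, mul_one]
  calc (2 : ℝ) ^ ((2 : ℝ≥0∞).toReal)⁻¹ ≤ (2 : ℝ) ^ (1 : ℝ) :=
        Real.rpow_le_rpow_of_exponent_le (by norm_num) (by norm_num)
    _ = 2 := Real.rpow_one 2

/-- The Dirichlet heat semigroup `exp (t κ d²/dr²) = ∑_{n ≥ 1} exp (-t κ λ_n) ⟨e_n, ·⟩ e_n` on
`L²(-1,1)`, for `t > 0`. The series converges in operator norm. -/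
noncomputable def heatSemigroup (κ t : ℝ) : L2I →L[ℝ] L2I :=
  ∑' n : ℕ, Real.exp (-(t * κ * eigenvalue (n + 1))) •
    InnerProductSpace.rankOne ℝ (modeL2 (n + 1)) (modeL2 (n + 1))

theorem summable_exp {κ t : ℝ} (hκ : 0 < κ) (ht : 0 < t) :
    Summable fun n : ℕ => Real.exp (-(t * κ * eigenvalue (n + 1))) := by
  have hc : 0 < t * κ := mul_pos ht hκ
  refine Summable.of_nonneg_of_le (fun _ => (Real.exp_pos _).le) (fun n => ?_)
    (Real.summable_exp_nat_mul_iff.mpr (neg_lt_zero.mpr hc))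
  refine Real.exp_le_exp.mpr ?_
  have h1 : (n : ℝ) ≤ eigenvalue (n + 1) := by
    have hp := Real.pi_gt_three
    have hn : (0 : ℝ) ≤ n := n.cast_nonneg
    have h2 : (n : ℝ) + 1 ≤ (n + 1) * Real.pi / 2 := by nlinarith
    unfold eigenvalue
    push_cast
    nlinarith
  nlinarith

theorem summable_heatSemigroup {κ t : ℝ} (hκ : 0 < κ) (ht : 0 < t) :
    Summable fun n : ℕ => Real.exp (-(t * κ * eigenvalue (n + 1))) •
      InnerProductSpace.rankOne ℝ (modeL2 (n + 1)) (modeL2 (n + 1)) := by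
  refine Summable.of_norm_bounded ((summable_exp hκ ht).mul_right 4) fun n => ?_
  rw [norm_smul, Real.norm_of_nonneg (Real.exp_pos _).le, InnerProductSpace.norm_rankOne]
  refine mul_le_mul_of_nonneg_left ?_ (Real.exp_pos _).le
  nlinarith [norm_modeL2_le (n + 1), norm_nonneg (modeL2 (n + 1))]

/-- The integral kernel of `exp (t κ d²/dr²)`, that is, the transition density of the Brownian
motion with generator `κ d²/dr²` absorbed at `±1`. -/
noncomputable def heatKernel (κ t r s : ℝ) : ℝ :=
  ∑' n : ℕ, Real.exp (-(t * κ * eigenvalue (n + 1))) * (mode (n + 1) r * mode (n + 1) s)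

theorem summable_heatKernel {κ t : ℝ} (hκ : 0 < κ) (ht : 0 < t) (r s : ℝ) :
    Summable fun n : ℕ => Real.exp (-(t * κ * eigenvalue (n + 1))) *
      (mode (n + 1) r * mode (n + 1) s) := by
  refine Summable.of_norm_bounded (summable_exp hκ ht) fun n => ?_
  rw [norm_mul, Real.norm_of_nonneg (Real.exp_pos _).le, Real.norm_eq_abs, abs_mul]
  exact mul_le_of_le_one_right (Real.exp_pos _).le
    (mul_le_one₀ (abs_mode_le _ _) (abs_nonneg _) (abs_mode_le _ _))

/-! ### Convergence to Brownian motion -/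

/-- The discretized initial measure, `(u₀)_x = L μ₀([x/L, (x+1)/L))`. -/
noncomputable def discretize (L : ℕ) (μ₀ : Measure ℝ) (x : box L) : ℝ :=
  L * μ₀.real (cell L x)

/-- Convergence of the rescaled semigroups to the heat semigroup in the operator norm of
`L²(-1,1)`, uniformly for `t` bounded away from `0`. -/
def NormConvergence (w : ℤ → ℝ≥0) (κ : ℝ) : Prop :=
  ∀ t₀ : ℝ, 0 < t₀ →
    TendstoUniformlyOn (fun (L : ℕ) (t : ℝ) => walkSemigroup L w t) (heatSemigroup κ) atTop
      (Set.Ici t₀)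

/-- Convergence of `(exp (L² t Δ_{L,w}) u₀)_{⌊L ξ⌋}` to `(exp (t κ d²/dr²) μ₀)(ξ)`, uniformly in
`ξ ∈ (-1,1)`, in `t` bounded away from `0`, and in the finite measures `μ₀` on `(-1,1)` (relative
to their total mass). -/
def DensityConvergence (w : ℤ → ℝ≥0) (κ : ℝ) : Prop :=
  ∀ t₀ : ℝ, 0 < t₀ → ∀ ε : ℝ, 0 < ε → ∀ᶠ L : ℕ in atTop,
    ∀ t : ℝ, t₀ ≤ t → ∀ ξ ∈ Set.Ioo (-1 : ℝ) 1,
      ∀ μ₀ : Measure ℝ, IsFiniteMeasure μ₀ → μ₀ (Set.Ioo (-1) 1)ᶜ = 0 →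
        |zeroExt ((transition L w ((L : ℝ) ^ 2 * t)).mulVec (discretize L μ₀)) ⌊(L : ℝ) * ξ⌋
          - ∫ ζ, heatKernel κ t ξ ζ ∂μ₀| ≤ ε * μ₀.real Set.univ

/-- The random walk in the environment `w`, diffusively rescaled and with absorbing boundary,
converges to Brownian motion on `(-1,1)` with diffusion coefficient `κ`. -/
def ConvergesToBrownianMotion (w : ℤ → ℝ≥0) (κ : ℝ) : Prop :=
  NormConvergence w κ ∧ DensityConvergence w κ

/-- A random environment is stationary if its law is invariant under all shifts of `ℤ`. -/
def IsStationary {Ω : Type*} [MeasurableSpace Ω] (P : Measure Ω) (w : ℤ → Ω → ℝ≥0) : Prop :=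
  ∀ k : ℤ, IdentDistrib (fun ω (z : ℤ) => w (z + k) ω) (fun ω (z : ℤ) => w z ω) P P

end RandomConductance

/-!
The plan is to reduce everything to the Green's function of the walk, which is explicit in dimension
one: with `s(x) = ∑_{-L ≤ z < x} 1 / w_z`, the inverse of `-L² Δ_{L,w}` is
`s(x ∧ y) (s(L) - s(x ∨ y)) / (L² s(L))` (`scaledGenerator_mul_green`), so it depends on the
environment only through the scaled resistances `s(⌊L ξ⌋) / L`. Almost surely these converge
uniformly to `(ξ + 1) / κ`.

Only averages to the right of the origin are assumed to converge, so averages to the left need an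
argument, and the environment need not be ergodic. Reverse Fatou for truncations and Fatou's lemma
show that `1 / w_0` has integral `κ⁻¹ P(A)` on every shift-invariant event `A`
(`lintegral_eq_of_tendsto_birkhoffSum`). In particular all `w_z` are almost surely positive. The
maximal ergodic lemma, applied on the invariant event that the averages along the inverse shift
exceed `κ⁻¹ + ε` infinitely often, shows that this event is null (`ae_tendsto_birkhoffSum_symm`).

The rest is deterministic. Put `H = -L² Δ_{L,w}` and `B = H⁻¹`. As the entries of `B` are `O(1/L)`,
a function `φ(H)` is bounded in the supremum norm, uniformly in `L`, once `s φ(s)` is bounded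
(`abs_specFun_mulVec_le`). In the homogeneous medium the sine vectors `x ↦ e_n(x/L)` are exact
eigenvectors, so in a general medium they are eigenvectors of `B` with eigenvalue `1 / (κ λ_n)` up
to a small error, and hence eigenvectors of `H exp (-t H)` up to a small error, uniformly in `t ≥ t₀`
(`abs_specFun_mulVec_sub_le`). Since `L B(·, y)` is close to the continuum Green's function
`κ⁻¹ ∑ λ_n⁻¹ e_n e_n(y/L)`, whose tail is uniformly small, the identity
`exp (-t H) = H exp (-t H) B` gives `L exp (-t H)(x, y) → ∑ exp (-t κ λ_n) e_n(x/L) e_n(y/L)`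
uniformly in `x`, `y` and `t ≥ t₀` (`abs_exp_apply_sub_sum_le`,
`eventually_abs_transition_sub_heatKernel_le`).

Uniform convergence of the kernels yields both conclusions: integrating against `μ₀` gives the
densities, and an integral operator on `L²(-1,1)` is bounded by a multiple of the supremum of its
kernel.
-/

namespace RandomConductance

/-! ### A maximal ergodic lemma and two-sided averages -/

section Ergodic

variable {X : Type*}

/-- The running maximum `max_{0 ≤ k ≤ n} ∑_{i < k} h (S^i x)` of the Birkhoff sums, defined by the
recursion `M_{n+1} = max 0 (h + M_n ∘ S)`. -/
noncomputable def maxBirkhoffSum (S : X → X) (h : X → ℝ) : ℕ → X → ℝ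
  | 0 => fun _ => 0
  | n + 1 => fun x => max 0 (h x + maxBirkhoffSum S h n (S x))

theorem maxBirkhoffSum_nonneg (S : X → X) (h : X → ℝ) (n : ℕ) (x : X) :
    0 ≤ maxBirkhoffSum S h n x := by
  cases n with
  | zero => exact le_rfl
  | succ n => exact le_max_left _ _

theorem birkhoffSum_le_maxBirkhoffSum (S : X → X) (h : X → ℝ) (n : ℕ) (x : X) :
    birkhoffSum S h n x ≤ maxBirkhoffSum S h n x := by
  induction n generalizing x with
  | zero => simp [maxBirkhoffSum]
  | succ n ih =>
    rw [birkhoffSum_succ']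
    exact (add_le_add_right (ih (S x)) (h x)).trans (le_max_right _ _)

theorem maxBirkhoffSum_le_succ (S : X → X) (h : X → ℝ) (n : ℕ) (x : X) :
    maxBirkhoffSum S h n x ≤ maxBirkhoffSum S h (n + 1) x := by
  induction n generalizing x with
  | zero => exact maxBirkhoffSum_nonneg S h 1 x
  | succ n ih => exact max_le_max le_rfl (add_le_add_right (ih (S x)) (h x))

/-- The Birkhoff sums at `x` and at `S x` differ by the term `g x` and a shift of the index by one,
so exceeding a slope infinitely often carries over to any smaller slope. -/
theorem frequently_birkhoffSum_apply {S : X → X} {g : X → ℝ} {p q : ℝ} (hqp : q < p) {x : X} :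
    ((∃ᶠ n : ℕ in atTop, n * p < birkhoffSum S g n x) →
      ∃ᶠ n : ℕ in atTop, n * q < birkhoffSum S g n (S x)) ∧
    ((∃ᶠ n : ℕ in atTop, n * p < birkhoffSum S g n (S x)) →
      ∃ᶠ n : ℕ in atTop, n * q < birkhoffSum S g n x) := by
  have hlarge : ∀ b : ℝ, ∀ᶠ n : ℕ in atTop, b ≤ n * (p - q) := fun b => by
    filter_upwards [eventually_ge_atTop ⌈b / (p - q)⌉₊] with n hn
    exact (div_le_iff₀ (sub_pos.mpr hqp)).mp ((Nat.le_ceil _).trans (by exact_mod_cast hn))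
  constructor <;> intro hf <;> rw [frequently_atTop] at hf ⊢ <;> intro N
  · obtain ⟨K, hK⟩ := eventually_atTop.mp (hlarge (g x - p))
    obtain ⟨n, hn, hlt⟩ := hf (max N K + 1)
    obtain ⟨m, rfl⟩ : ∃ m, n = m + 1 := ⟨n - 1, by omega⟩
    refine ⟨m, by omega, ?_⟩
    have := hK m (by omega)
    rw [birkhoffSum_succ'] at hlt
    push_cast at hlt
    linarith
  · obtain ⟨K, hK⟩ := eventually_atTop.mp (hlarge (q - g x))
    obtain ⟨m, hm, hlt⟩ := hf (max N K)
    refine ⟨m + 1, by omega, ?_⟩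
    have := hK m (by omega)
    rw [birkhoffSum_succ']
    push_cast
    linarith

variable [MeasurableSpace X] {μ : Measure X} {S : X → X} {h : X → ℝ}

theorem measurable_maxBirkhoffSum (hS : Measurable S) (hh : Measurable h) (n : ℕ) :
    Measurable (maxBirkhoffSum S h n) := by
  induction n with
  | zero => exact measurable_const
  | succ n ih => exact measurable_const.max (hh.add (ih.comp hS))

theorem integrable_maxBirkhoffSum (hS : MeasurePreserving S μ μ) (hi : Integrable h μ) (n : ℕ) :
    Integrable (maxBirkhoffSum S h n) μ := by
  induction n with
  | zero => exact integrable_zero X ℝ μ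
  | succ n ih =>
    have := (hi.add (hS.integrable_comp_of_integrable ih)).pos_part
    refine this.congr (Eventually.of_forall fun x => ?_)
    simp [maxBirkhoffSum, max_comm]

/-- Garsia's form of the maximal ergodic lemma. -/
theorem setIntegral_maxBirkhoffSum_pos_nonneg (hS : MeasurePreserving S μ μ) (hh : Measurable h)
    (hi : Integrable h μ) (n : ℕ) : 0 ≤ ∫ x in {x | 0 < maxBirkhoffSum S h n x}, h x ∂μ := by
  have hM := integrable_maxBirkhoffSum hS hi n
  have hMm := measurable_maxBirkhoffSum hS.measurable hh n
  have hMS : Integrable (fun x => maxBirkhoffSum S h n (S x)) μ :=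
    hS.integrable_comp_of_integrable hM
  have hs : MeasurableSet {x | 0 < maxBirkhoffSum S h n x} := measurableSet_lt measurable_const hMm
  set s := {x | 0 < maxBirkhoffSum S h n x}
  have h1 : ∫ x in s, maxBirkhoffSum S h n x ∂μ = ∫ x, maxBirkhoffSum S h n x ∂μ :=
    setIntegral_eq_integral_of_forall_compl_eq_zero fun x hx =>
      le_antisymm (not_lt.mp hx) (maxBirkhoffSum_nonneg S h n x)
  have h2 : ∫ x in s, maxBirkhoffSum S h n x ∂μ
      ≤ ∫ x in s, (h x + maxBirkhoffSum S h n (S x)) ∂μ := by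
    refine setIntegral_mono_on hM.integrableOn (hi.add hMS).integrableOn hs fun x hx => ?_
    cases n with
    | zero => exact absurd (show (0 : ℝ) < 0 from hx) (lt_irrefl _)
    | succ n =>
      have hx' : 0 < max 0 (h x + maxBirkhoffSum S h n (S x)) := hx
      have : maxBirkhoffSum S h (n + 1) x = h x + maxBirkhoffSum S h n (S x) :=
        max_eq_right ((lt_max_iff.mp hx').resolve_left (lt_irrefl _)).le
      rw [this]
      exact add_le_add_right (maxBirkhoffSum_le_succ S h n (S x)) _
  have h3 : ∫ x in s, maxBirkhoffSum S h n (S x) ∂μ ≤ ∫ x, maxBirkhoffSum S h n (S x) ∂μ :=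
    setIntegral_le_integral hMS (Eventually.of_forall fun x => maxBirkhoffSum_nonneg S h n (S x))
  have h4 : ∫ x, maxBirkhoffSum S h n (S x) ∂μ = ∫ x, maxBirkhoffSum S h n x ∂μ := by
    conv_rhs => rw [← hS.map_eq]
    exact (integral_map hS.aemeasurable hMm.aestronglyMeasurable).symm
  rw [integral_add hi.integrableOn hMS.integrableOn] at h2
  linarith

/-- If almost every point has a positive Birkhoff sum of `h`, then `h` has non-negative integral. -/
theorem integral_nonneg_of_exists_birkhoffSum_pos (hS : MeasurePreserving S μ μ)
    (hh : Measurable h) (hi : Integrable h μ) (hpos : ∀ᵐ x ∂μ, ∃ n, 0 < birkhoffSum S h n x) :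
    0 ≤ ∫ x, h x ∂μ := by
  have hmono : Monotone fun n => {x | 0 < maxBirkhoffSum S h n x} :=
    monotone_nat_of_le_succ fun n x hx => lt_of_lt_of_le hx (maxBirkhoffSum_le_succ S h n x)
  have hlim := tendsto_setIntegral_of_monotone (μ := μ) (f := h)
    (fun n => measurableSet_lt measurable_const (measurable_maxBirkhoffSum hS.measurable hh n))
    hmono hi.integrableOn
  have hfull : (⋃ n, {x | 0 < maxBirkhoffSum S h n x}) =ᵐ[μ] Set.univ := by
    refine eventuallyEq_univ.mpr ?_
    filter_upwards [hpos] with x ⟨n, hn⟩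
    exact Set.mem_iUnion.mpr ⟨n, hn.trans_le (birkhoffSum_le_maxBirkhoffSum S h n x)⟩
  rw [setIntegral_congr_set hfull, setIntegral_univ] at hlim
  exact ge_of_tendsto' hlim (setIntegral_maxBirkhoffSum_pos_nonneg hS hh hi)

variable {g : X → ℝ} {c : ℝ}

theorem measurable_birkhoffSum {E : Type*} [AddCommMonoid E] [MeasurableSpace E]
    [MeasurableAdd₂ E] {f : X → E} (hS : Measurable S) (hf : Measurable f) (n : ℕ) :
    Measurable (birkhoffSum S f n) :=
  Finset.measurable_sum _ fun i _ => hf.comp (hS.iterate i)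

/-- One half of the pointwise ergodic theorem, for a function whose conditional expectation given
the invariant sets is the constant `c`. -/
theorem ae_eventually_birkhoffSum_le [IsFiniteMeasure μ] (hS : MeasurePreserving S μ μ)
    (hg : Measurable g) (hi : Integrable g μ)
    (hA : ∀ A, MeasurableSet A → S ⁻¹' A = A → ∫ x in A, g x ∂μ = c * μ.real A)
    {ε : ℝ} (hε : 0 < ε) :
    ∀ᵐ x ∂μ, ∀ᶠ n : ℕ in atTop, birkhoffSum S g n x ≤ n * (c + ε) := by
  -- Quantifying over all slopes above `c + ε / 2` makes the exceptional set exactly invariant.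
  set A : Set X := {x | ∃ q : ℚ, c + ε / 2 < q ∧
    ∃ᶠ n : ℕ in atTop, n * (q : ℝ) < birkhoffSum S g n x}
    with hAdef
  have hAm : MeasurableSet A := by
    have : A = ⋃ q : ℚ, ⋃ _ : c + ε / 2 < q, ⋂ N : ℕ, ⋃ n : ℕ, ⋃ _ : N ≤ n,
        {x | n * (q : ℝ) < birkhoffSum S g n x} := by
      ext x
      simp [hAdef, frequently_atTop]
    rw [this]
    exact MeasurableSet.iUnion fun q => MeasurableSet.iUnion fun _ => MeasurableSet.iInter fun N =>
      MeasurableSet.iUnion fun n => MeasurableSet.iUnion fun _ =>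
        measurableSet_lt measurable_const (measurable_birkhoffSum hS.measurable hg n)
  have hAinv : S ⁻¹' A = A := by
    ext x
    constructor
    · rintro ⟨q, hq, hf⟩
      obtain ⟨r, hr, hrq⟩ := exists_rat_btwn hq
      exact ⟨r, hr, (frequently_birkhoffSum_apply hrq).2 hf⟩
    · rintro ⟨q, hq, hf⟩
      obtain ⟨r, hr, hrq⟩ := exists_rat_btwn hq
      exact ⟨r, hr, (frequently_birkhoffSum_apply hrq).1 hf⟩
  have hSA : MeasurePreserving S (μ.restrict A) (μ.restrict A) := by
    simpa only [hAinv] using hS.restrict_preimage hAm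
  have key : 0 ≤ ∫ x in A, (g x - (c + ε / 2)) ∂μ := by
    refine integral_nonneg_of_exists_birkhoffSum_pos hSA (hg.sub_const _)
      (hi.integrableOn.sub (integrable_const _)) ?_
    refine (ae_restrict_iff' hAm).mpr (Eventually.of_forall ?_)
    rintro x ⟨q, hq, hf⟩
    obtain ⟨n, hn, hlt⟩ := (frequently_atTop.mp hf) 1
    refine ⟨n, ?_⟩
    have h1 : birkhoffSum S (fun x => g x - (c + ε / 2)) n x
        = birkhoffSum S g n x - n * (c + ε / 2) := by
      simp only [birkhoffSum, Finset.sum_sub_distrib, Finset.sum_const, Finset.card_range,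
        nsmul_eq_mul]
    have h2 : (0 : ℝ) < n := by exact_mod_cast hn
    rw [h1]
    nlinarith
  rw [integral_sub hi.integrableOn (integrable_const _), hA A hAm hAinv, setIntegral_const,
    smul_eq_mul] at key
  have hzero : μ A = 0 := by
    have : μ.real A = 0 := le_antisymm (by nlinarith) measureReal_nonneg
    exact (measureReal_eq_zero_iff).mp this
  filter_upwards [measure_eq_zero_iff_ae_notMem.mp hzero] with x hx
  obtain ⟨q, hq, hq'⟩ := exists_rat_btwn (show c + ε / 2 < c + ε by linarith)
  have hnf : ¬ ∃ᶠ n : ℕ in atTop, n * (q : ℝ) < birkhoffSum S g n x := fun hf => hx ⟨q, hq, hf⟩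
  filter_upwards [not_frequently.mp hnf] with n hn
  exact (not_lt.mp hn).trans (mul_le_mul_of_nonneg_left hq'.le n.cast_nonneg)

theorem ae_tendsto_birkhoffSum_div [IsFiniteMeasure μ] (hS : MeasurePreserving S μ μ)
    (hg : Measurable g) (hi : Integrable g μ)
    (hA : ∀ A, MeasurableSet A → S ⁻¹' A = A → ∫ x in A, g x ∂μ = c * μ.real A) :
    ∀ᵐ x ∂μ, Tendsto (fun n : ℕ => birkhoffSum S g n x / n) atTop (𝓝 c) := by
  have hup : ∀ᵐ x ∂μ, ∀ k : ℕ, ∀ᶠ n : ℕ in atTop,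
      birkhoffSum S g n x ≤ n * (c + 1 / ((k : ℝ) + 1)) :=
    ae_all_iff.mpr fun k => ae_eventually_birkhoffSum_le hS hg hi hA Nat.one_div_pos_of_nat
  have hlow : ∀ᵐ x ∂μ, ∀ k : ℕ, ∀ᶠ n : ℕ in atTop,
      birkhoffSum S (-g) n x ≤ n * (-c + 1 / ((k : ℝ) + 1)) :=
    ae_all_iff.mpr fun k => ae_eventually_birkhoffSum_le hS hg.neg hi.neg
      (fun A hAm hAi => by simp [integral_neg, hA A hAm hAi]) Nat.one_div_pos_of_nat
  filter_upwards [hup, hlow] with x hu hl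
  rw [Metric.tendsto_atTop']
  intro ε hε
  obtain ⟨k, hk⟩ := exists_nat_one_div_lt hε
  obtain ⟨N, hN⟩ := eventually_atTop.mp ((hu k).and (hl k))
  refine ⟨N, fun n hn => ?_⟩
  obtain ⟨h1, h2⟩ := hN n hn.le
  have hn0 : (0 : ℝ) < n := by exact_mod_cast (Nat.zero_le N).trans_lt hn
  rw [birkhoffSum_neg] at h2
  have h1' : birkhoffSum S g n x / n ≤ c + 1 / ((k : ℝ) + 1) := by
    rw [div_le_iff₀ hn0]; linarith
  have h2' : c - 1 / ((k : ℝ) + 1) ≤ birkhoffSum S g n x / n := by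
    rw [le_div_iff₀ hn0]; linarith
  rw [Real.dist_eq, abs_lt]
  constructor <;> linarith

/-- If the Birkhoff averages of a non-negative function converge to a finite constant, then the
function is integrable with the expected integral; no ergodic theorem is needed. -/
theorem lintegral_eq_of_tendsto_birkhoffSum [IsFiniteMeasure μ] (hS : MeasurePreserving S μ μ)
    {f : X → ℝ≥0∞} (hf : Measurable f) {c : ℝ≥0∞}
    (hlim : ∀ᵐ x ∂μ, Tendsto (fun n : ℕ => birkhoffSum S f n x / n) atTop (𝓝 c)) :
    ∫⁻ x, f x ∂μ = c * μ Set.univ := by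
  have hsum : ∀ {k : X → ℝ≥0∞}, Measurable k → ∀ n : ℕ, n ≠ 0 →
      ∫⁻ x, birkhoffSum S k n x / n ∂μ = ∫⁻ x, k x ∂μ := by
    intro k hk n hn
    simp_rw [div_eq_mul_inv]
    rw [lintegral_mul_const _ (measurable_birkhoffSum hS.measurable hk n)]
    have : ∫⁻ x, birkhoffSum S k n x ∂μ = n * ∫⁻ x, k x ∂μ := by
      unfold birkhoffSum
      rw [lintegral_finsetSum (Finset.range n) (f := fun i x => k (S^[i] x))
        fun i _ => hk.comp (hS.measurable.iterate i)]
      simp [(hS.iterate _).lintegral_comp hk]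
    rw [this, mul_comm, ← mul_assoc, ENNReal.inv_mul_cancel (by exact_mod_cast hn)
      (ENNReal.natCast_ne_top n), one_mul]
  have hconst : ∫⁻ _, c ∂μ = c * μ Set.univ := lintegral_const c
  rw [← hconst]
  apply le_antisymm
  · have htrunc : ∀ M : ℕ, ∫⁻ x, min (f x) M ∂μ ≤ ∫⁻ _, c ∂μ := by
      intro M
      have hm : Measurable fun x => min (f x) (M : ℝ≥0∞) := hf.min measurable_const
      have hle : ∀ n x, birkhoffSum S (fun x => min (f x) (M : ℝ≥0∞)) n x / n ≤ M := by
        intro n x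
        refine ENNReal.div_le_of_le_mul ?_
        refine (Finset.sum_le_sum fun i _ => min_le_right _ _).trans ?_
        simp [mul_comm]
      have h1 := limsup_lintegral_le (μ := μ) (fun _ => (M : ℝ≥0∞))
        (f := fun n x => birkhoffSum S (fun x => min (f x) (M : ℝ≥0∞)) n x / n)
        (fun n => (measurable_birkhoffSum hS.measurable hm n).div_const _)
        (fun n => Eventually.of_forall (hle n)) (by
          rw [lintegral_const]
          exact ENNReal.mul_ne_top (ENNReal.natCast_ne_top M) (measure_ne_top μ _))
      have h2 : limsup (fun n : ℕ => ∫⁻ x, birkhoffSum S (fun x => min (f x) (M : ℝ≥0∞)) n x / n ∂μ)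
          atTop = ∫⁻ x, min (f x) M ∂μ := by
        refine Tendsto.limsup_eq (tendsto_const_nhds.congr' ?_)
        filter_upwards [eventually_ne_atTop 0] with n hn
        exact (hsum hm n hn).symm
      rw [h2] at h1
      refine h1.trans (lintegral_mono_ae ?_)
      filter_upwards [hlim] with x hx
      rw [← hx.limsup_eq]
      refine limsup_le_limsup (Eventually.of_forall fun n => ?_)
      exact ENNReal.div_le_div_right (Finset.sum_le_sum fun i _ => min_le_left _ _) _
    have hmono : Tendsto (fun M : ℕ => ∫⁻ x, min (f x) M ∂μ) atTop (𝓝 (∫⁻ x, f x ∂μ)) := by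
      refine lintegral_tendsto_of_tendsto_of_monotone
        (fun M => (hf.min measurable_const).aemeasurable)
        (Eventually.of_forall fun x M N h => min_le_min le_rfl (by exact_mod_cast h))
        (Eventually.of_forall fun x => ?_)
      have := (tendsto_const_nhds (x := f x)).min ENNReal.tendsto_nat_nhds_top
      simpa using this
    exact le_of_tendsto' hmono htrunc
  · calc ∫⁻ _, c ∂μ = ∫⁻ x, liminf (fun n : ℕ => birkhoffSum S f n x / n) atTop ∂μ := by
          refine lintegral_congr_ae ?_
          filter_upwards [hlim] with x hx using hx.liminf_eq.symm
      _ ≤ liminf (fun n : ℕ => ∫⁻ x, birkhoffSum S f n x / n ∂μ) atTop :=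
          lintegral_liminf_le fun n => (measurable_birkhoffSum hS.measurable hf n).div_const _
      _ = ∫⁻ x, f x ∂μ := by
          refine Tendsto.liminf_eq (tendsto_const_nhds.congr' ?_)
          filter_upwards [eventually_ne_atTop 0] with n hn
          exact (hsum hf n hn).symm

/-- For an invertible transformation, convergence of the forward averages to a finite constant
forces finiteness of the function and the same limit for forward and backward averages. -/
theorem ae_tendsto_birkhoffSum_symm [IsFiniteMeasure μ] (e : X ≃ᵐ X)
    (he : MeasurePreserving e μ μ) {f : X → ℝ≥0∞} (hf : Measurable f) {c : ℝ≥0∞} (hc : c ≠ ∞)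
    (hlim : ∀ᵐ x ∂μ, Tendsto (fun n : ℕ => birkhoffSum e f n x / n) atTop (𝓝 c)) :
    (∀ᵐ x ∂μ, f x ≠ ∞) ∧
    (∀ᵐ x ∂μ, Tendsto (fun n : ℕ => birkhoffSum e (fun x => (f x).toReal) n x / n) atTop
      (𝓝 c.toReal)) ∧
    ∀ᵐ x ∂μ, Tendsto (fun n : ℕ => birkhoffSum e.symm (fun x => (f x).toReal) n x / n) atTop
      (𝓝 c.toReal) := by
  have hA : ∀ A, MeasurableSet A → e ⁻¹' A = A → ∫⁻ x in A, f x ∂μ = c * μ A := by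
    intro A hAm hAi
    have heA : MeasurePreserving e (μ.restrict A) (μ.restrict A) := by
      simpa only [hAi] using he.restrict_preimage hAm
    simpa using lintegral_eq_of_tendsto_birkhoffSum heA hf (ae_restrict_of_ae hlim)
  have hfin : ∫⁻ x, f x ∂μ ≠ ∞ := by
    rw [← setLIntegral_univ, hA Set.univ MeasurableSet.univ rfl]
    exact ENNReal.mul_ne_top hc (measure_ne_top _ _)
  have hi : Integrable (fun x => (f x).toReal) μ := integrable_toReal_of_lintegral_ne_top
    hf.aemeasurable hfin
  have hA' : ∀ A, MeasurableSet A → e ⁻¹' A = A →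
      ∫ x in A, (f x).toReal ∂μ = c.toReal * μ.real A := by
    intro A hAm hAi
    rw [integral_toReal hf.aemeasurable (ae_restrict_of_ae (ae_lt_top hf hfin)), hA A hAm hAi,
      ENNReal.toReal_mul, measureReal_def]
  refine ⟨(ae_lt_top hf hfin).mono fun x hx => hx.ne,
    ae_tendsto_birkhoffSum_div he hf.ennreal_toReal hi hA',
    ae_tendsto_birkhoffSum_div (he.symm e) hf.ennreal_toReal hi fun A hAm hAi => hA' A hAm ?_⟩
  ext x
  have : e.symm (e x) ∈ A ↔ e x ∈ A := by
    conv_rhs => rw [← hAi]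
    rfl
  simpa using this.symm

end Ergodic

/-! ### Functions of a symmetric matrix with a small inverse -/

section Spectral

variable {ι : Type*} [Fintype ι] [DecidableEq ι] {H B : Matrix ι ι ℝ}

/-- The matrix `φ(H)`, defined through the spectral decomposition of the symmetric matrix `H`. -/
noncomputable def specFun (hH : H.IsHermitian) (φ : ℝ → ℝ) : Matrix ι ι ℝ :=
  (hH.eigenvectorUnitary : Matrix ι ι ℝ) * Matrix.diagonal (fun i => φ (hH.eigenvalues i)) *
    star (hH.eigenvectorUnitary : Matrix ι ι ℝ)

theorem specFun_mul (hH : H.IsHermitian) (φ ψ : ℝ → ℝ) :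
    specFun hH φ * specFun hH ψ = specFun hH fun s => φ s * ψ s := by
  have h : star (hH.eigenvectorUnitary : Matrix ι ι ℝ) *
      (hH.eigenvectorUnitary : Matrix ι ι ℝ) = 1 :=
    Unitary.coe_star_mul_self _
  unfold specFun
  rw [← Matrix.diagonal_mul_diagonal]
  simp only [Matrix.mul_assoc]
  rw [← Matrix.mul_assoc (star _) _ (_ * _), h, Matrix.one_mul]

theorem specFun_congr (hH : H.IsHermitian) {φ ψ : ℝ → ℝ}
    (h : ∀ i, φ (hH.eigenvalues i) = ψ (hH.eigenvalues i)) : specFun hH φ = specFun hH ψ := by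
  unfold specFun
  simp only [h]

theorem specFun_id (hH : H.IsHermitian) : specFun hH (fun s => s) = H := by
  conv_rhs => rw [hH.spectral_theorem]
  rfl

theorem specFun_sub (hH : H.IsHermitian) (φ ψ : ℝ → ℝ) :
    specFun hH (fun s => φ s - ψ s) = specFun hH φ - specFun hH ψ := by
  unfold specFun
  rw [← Matrix.diagonal_sub, Matrix.mul_sub, Matrix.sub_mul]

theorem specFun_const (hH : H.IsHermitian) (c : ℝ) : specFun hH (fun _ => c) = c • 1 := by
  have h : (hH.eigenvectorUnitary : Matrix ι ι ℝ) *
      star (hH.eigenvectorUnitary : Matrix ι ι ℝ) = 1 :=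
    Unitary.coe_mul_star_self _
  unfold specFun
  rw [← Matrix.smul_one_eq_diagonal, Matrix.mul_smul, Matrix.mul_one, Matrix.smul_mul, h]

theorem exp_smul_eq_specFun (hH : H.IsHermitian) (c : ℝ) :
    NormedSpace.exp (c • H) = specFun hH fun s => Real.exp (c * s) := by
  have h : (hH.eigenvectorUnitary : Matrix ι ι ℝ) *
      star (hH.eigenvectorUnitary : Matrix ι ι ℝ) = 1 :=
    Unitary.coe_mul_star_self _
  have hcH : c • H = (hH.eigenvectorUnitary : Matrix ι ι ℝ) *
      Matrix.diagonal (fun i => c * hH.eigenvalues i) *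
        (hH.eigenvectorUnitary : Matrix ι ι ℝ)⁻¹ := by
    rw [Matrix.inv_eq_right_inv h]
    conv_lhs => rw [← specFun_id hH, specFun, ← Matrix.smul_mul, ← Matrix.mul_smul]
    congr 2
    ext i j
    by_cases hij : i = j <;> simp [hij]
  rw [hcH, Matrix.exp_conj _ _ (IsUnit.of_mul_eq_one _ h), Matrix.exp_diagonal,
    Matrix.inv_eq_right_inv h, specFun]
  congr 3
  ext i
  rw [Pi.exp_def, Real.exp_eq_exp_ℝ]

theorem sum_sq_specFun_mulVec_le (hH : H.IsHermitian) {φ : ℝ → ℝ} {c : ℝ}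
    (hφ : ∀ i, |φ (hH.eigenvalues i)| ≤ c) (u : ι → ℝ) :
    ∑ x, ((specFun hH φ).mulVec u x) ^ 2 ≤ c ^ 2 * ∑ x, u x ^ 2 := by
  set U : Matrix ι ι ℝ := (hH.eigenvectorUnitary : Matrix ι ι ℝ) with hU
  have h1 : star U * U = 1 := Unitary.coe_star_mul_self _
  have h2 : U * star U = 1 := Unitary.coe_mul_star_self _
  have hiso : ∀ V : Matrix ι ι ℝ, star V * V = 1 → ∀ v : ι → ℝ,
      ∑ x, (V.mulVec v x) ^ 2 = ∑ x, v x ^ 2 := by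
    intro V hV v
    have : dotProduct (V.mulVec v) (V.mulVec v) = dotProduct v v := by
      rw [Matrix.dotProduct_mulVec, ← Matrix.mulVec_transpose, Matrix.mulVec_mulVec]
      have hVt : V.transpose = star V := by
        ext i j
        simp [Matrix.star_apply]
      rw [hVt, hV, Matrix.one_mulVec]
    simpa [dotProduct, sq] using this
  have hs : (specFun hH φ).mulVec u
      = U.mulVec (fun i => φ (hH.eigenvalues i) * (star U).mulVec u i) := by
    rw [specFun, ← Matrix.mulVec_mulVec, ← Matrix.mulVec_mulVec]
    congr 1
    ext i
    exact Matrix.mulVec_diagonal _ _ i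
  rw [hs, hiso U h1, ← hiso (star U) (by rw [star_star]; exact h2) u, Finset.mul_sum]
  refine Finset.sum_le_sum fun i _ => ?_
  rw [mul_pow]
  exact mul_le_mul_of_nonneg_right (sq_le_sq' (abs_le.mp (hφ i)).1 (abs_le.mp (hφ i)).2)
    (sq_nonneg _)

theorem eq_specFun_inv (hH : H.IsHermitian) (hpos : ∀ i, 0 < hH.eigenvalues i) (hBH : B * H = 1) :
    B = specFun hH fun s => s⁻¹ := by
  have h : H * specFun hH (fun s => s⁻¹) = 1 := by
    refine Eq.trans (b := specFun hH (fun s => s) * specFun hH fun s => s⁻¹) (by rw [specFun_id]) ?_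
    rw [specFun_mul, specFun_congr hH (ψ := fun _ => 1) fun i => mul_inv_cancel₀ (hpos i).ne',
      specFun_const, one_smul]
  calc B = B * (H * specFun hH fun s => s⁻¹) := by rw [h, Matrix.mul_one]
    _ = specFun hH fun s => s⁻¹ := by rw [← Matrix.mul_assoc, hBH, Matrix.one_mul]

/-- If the inverse `B` of `H` has entries of size `C / ℓ`, where `2 ℓ` bounds the dimension, then
`φ(H)` is bounded in the supremum norm as soon as `s φ(s)` is bounded, uniformly in `ℓ`: write
`φ(H) = B · (H φ(H))`, bound the second factor in `ℓ²` and use that `B` maps `ℓ²` to `ℓ^∞`. -/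
theorem abs_specFun_mulVec_le (hH : H.IsHermitian) (hpos : ∀ i, 0 < hH.eigenvalues i)
    (hBH : B * H = 1) {C ℓ : ℝ} (hC : 0 ≤ C) (hℓ : 0 < ℓ) (hB : ∀ x y, |B x y| ≤ C / ℓ)
    (hcard : (Fintype.card ι : ℝ) ≤ 2 * ℓ) {φ : ℝ → ℝ} {c : ℝ} (hc : 0 ≤ c)
    (hφ : ∀ s, 0 < s → |s * φ s| ≤ c) {v : ι → ℝ} {m : ℝ} (hm : 0 ≤ m) (hv : ∀ x, |v x| ≤ m)
    (x : ι) : |(specFun hH φ).mulVec v x| ≤ 2 * C * c * m := by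
  have hfac : specFun hH φ = B * specFun hH fun s => s * φ s := by
    rw [eq_specFun_inv hH hpos hBH, specFun_mul]
    refine specFun_congr hH fun i => ?_
    rw [← mul_assoc, inv_mul_cancel₀ (hpos i).ne', one_mul]
  rw [hfac, ← Matrix.mulVec_mulVec]
  set w := (specFun hH fun s => s * φ s).mulVec v with hw
  have hsq : ∀ {f : ι → ℝ} {d : ℝ}, 0 ≤ d → (∀ x, |f x| ≤ d) → ∑ x, f x ^ 2 ≤ 2 * ℓ * d ^ 2 := by
    intro f d hd hf
    calc ∑ x, f x ^ 2 ≤ ∑ _x : ι, d ^ 2 := Finset.sum_le_sum fun x _ =>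
          sq_le_sq' (abs_le.mp (hf x)).1 (abs_le.mp (hf x)).2
      _ = Fintype.card ι * d ^ 2 := by simp
      _ ≤ 2 * ℓ * d ^ 2 := mul_le_mul_of_nonneg_right hcard (sq_nonneg d)
  have h1 : ∑ y, w y ^ 2 ≤ c ^ 2 * (2 * ℓ * m ^ 2) :=
    (sum_sq_specFun_mulVec_le hH (fun i => hφ _ (hpos i)) v).trans
      (mul_le_mul_of_nonneg_left (hsq hm hv) (sq_nonneg c))
  have h2 : ∑ y, B x y ^ 2 ≤ 2 * ℓ * (C / ℓ) ^ 2 := hsq (by positivity) (hB x)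
  refine abs_le_of_sq_le_sq ?_ (by positivity)
  calc (B.mulVec w x) ^ 2 ≤ (∑ y, B x y ^ 2) * ∑ y, w y ^ 2 :=
        Finset.sum_mul_sq_le_sq_mul_sq Finset.univ (B x) w
    _ ≤ (2 * ℓ * (C / ℓ) ^ 2) * (c ^ 2 * (2 * ℓ * m ^ 2)) :=
        mul_le_mul h2 h1 (Finset.sum_nonneg fun _ _ => sq_nonneg _) (by positivity)
    _ = (2 * C * c * m) ^ 2 := by field_simp

/-! ### Scalar bounds for `s exp (-t s)` -/

theorem mul_exp_neg_le {t₀ t s : ℝ} (ht₀ : 0 < t₀) (ht : t₀ ≤ t) (hs : 0 ≤ s) :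
    s * Real.exp (-(t * s)) ≤ 1 / t₀ := by
  have h1 : t * s ≤ Real.exp (t * s) := by linarith [Real.add_one_le_exp (t * s)]
  rw [Real.exp_neg, ← div_eq_mul_inv, div_le_div_iff₀ (Real.exp_pos _) ht₀]
  nlinarith

theorem sq_mul_exp_neg_le {t₀ t s : ℝ} (ht₀ : 0 < t₀) (ht : t₀ ≤ t) (hs : 0 ≤ s) :
    s * (s * Real.exp (-(t * s))) ≤ 2 / t₀ ^ 2 := by
  have hts : 0 ≤ t * s := mul_nonneg (ht₀.le.trans ht) hs
  have h1 : (t * s) ^ 2 ≤ 2 * Real.exp (t * s) := by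
    linarith [Real.quadratic_le_exp_of_nonneg hts]
  have h2 : (t₀ * s) ^ 2 ≤ (t * s) ^ 2 :=
    pow_le_pow_left₀ (mul_nonneg ht₀.le hs) (mul_le_mul_of_nonneg_right ht hs) 2
  rw [Real.exp_neg, ← mul_assoc, ← div_eq_mul_inv, div_le_div_iff₀ (Real.exp_pos _) (by positivity)]
  nlinarith

theorem abs_mul_exp_neg_sub_le {t s r : ℝ} (ht : 0 ≤ t) (hs : 0 ≤ s) (hr : 0 ≤ r) :
    |s * Real.exp (-(t * s)) - r * Real.exp (-(t * r))| ≤ |s - r| := by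
  have hd : ∀ x : ℝ, HasDerivAt (fun x => x * Real.exp (-(t * x)))
      ((1 - t * x) * Real.exp (-(t * x))) x := by
    intro x
    have h1 : HasDerivAt (fun x : ℝ => -(t * x)) (-t) x := by
      simpa using ((hasDerivAt_id' x).const_mul t).fun_neg
    refine ((hasDerivAt_id' x).mul h1.exp).congr_deriv ?_
    ring
  have := (convex_Ici (0 : ℝ)).norm_image_sub_le_of_norm_hasDerivWithin_le (C := 1)
    (f := fun x => x * Real.exp (-(t * x))) (fun x _ => (hd x).hasDerivWithinAt) (fun x hx => ?_)
    (Set.mem_Ici.mpr hr) (Set.mem_Ici.mpr hs)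
  · simpa using this
  · have htx : 0 ≤ t * x := mul_nonneg ht hx
    have h1 := Real.add_one_le_exp (t * x)
    rw [Real.norm_eq_abs, abs_mul, Real.abs_exp, Real.exp_neg, ← div_eq_mul_inv,
      div_le_one (Real.exp_pos _), abs_le]
    constructor <;> linarith

/-! ### Approximate eigenvectors and the semigroup -/

/-- The constant in `abs_specFun_mulVec_sub_le`. -/
noncomputable def quasimodeConst (C t₀ μ : ℝ) : ℝ :=
  μ / t₀ + 2 * C * (2 * μ / t₀ ^ 2 + μ ^ 2 / t₀ + μ ^ 3)

/-- If `v` is an eigenvector of `B = H⁻¹` with eigenvalue `1 / μ` up to an error `δ` in the supremum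
norm, then it is an eigenvector of `H exp (-t H)` up to an error of order `δ`, uniformly in
`t ≥ t₀`. -/
theorem abs_specFun_mulVec_sub_le (hH : H.IsHermitian) (hpos : ∀ i, 0 < hH.eigenvalues i)
    (hBH : B * H = 1) {C ℓ : ℝ} (hC : 0 ≤ C) (hℓ : 0 < ℓ) (hB : ∀ x y, |B x y| ≤ C / ℓ)
    (hcard : (Fintype.card ι : ℝ) ≤ 2 * ℓ) {t₀ t μ δ : ℝ} (ht₀ : 0 < t₀) (ht : t₀ ≤ t) (hμ : 0 < μ)
    (hδ : 0 ≤ δ) {v : ι → ℝ} (hv : ∀ x, |B.mulVec v x - v x / μ| ≤ δ) (x : ι) :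
    |(specFun hH fun s => s * Real.exp (-(t * s))).mulVec v x - μ * Real.exp (-(t * μ)) * v x|
      ≤ quasimodeConst C t₀ μ * δ := by
  set φ : ℝ → ℝ := fun s => s * Real.exp (-(t * s)) with hφdef
  have hφ0 : ∀ s, 0 ≤ s → 0 ≤ φ s := fun s hs => mul_nonneg hs (Real.exp_pos _).le
  have hφ1 : ∀ s, 0 ≤ s → φ s ≤ 1 / t₀ := fun s hs => mul_exp_neg_le ht₀ ht hs
  -- `φ(H) v - φ(μ) v = χ(H) r - μ φ(μ) r`, where `r = v / μ - B v`.
  set χ : ℝ → ℝ := fun s => μ * φ s + μ ^ 2 * ((φ s - φ μ) / (s - μ)) with hχdef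
  set r : ι → ℝ := (specFun hH fun s => 1 / μ - s⁻¹).mulVec v with hr
  have hrx : ∀ x, r x = v x / μ - B.mulVec v x := by
    intro x
    rw [hr, specFun_sub, ← eq_specFun_inv hH hpos hBH, specFun_const, Matrix.sub_mulVec,
      Matrix.smul_mulVec, Matrix.one_mulVec]
    simp only [Pi.sub_apply, Pi.smul_apply, smul_eq_mul]
    ring
  have hrδ : ∀ x, |r x| ≤ δ := fun x => by rw [hrx, abs_sub_comm]; exact hv x
  have hid : (specFun hH φ).mulVec v x - φ μ * v x
      = (specFun hH χ).mulVec r x - μ * φ μ * r x := by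
    have hmat : specFun hH (fun s => φ s - φ μ)
        = specFun hH (fun s => χ s - μ * φ μ) * specFun hH fun s => 1 / μ - s⁻¹ := by
      rw [specFun_mul]
      refine specFun_congr hH fun i => ?_
      have hi := hpos i
      generalize hH.eigenvalues i = s at hi
      simp only [hχdef]
      rcases eq_or_ne s μ with rfl | hne
      · simp
      · have : s - μ ≠ 0 := sub_ne_zero.mpr hne
        field_simp
        ring
    have h := congrArg (fun M => M.mulVec v x) hmat
    simp only [← Matrix.mulVec_mulVec, ← hr] at h
    rw [specFun_sub, specFun_sub, specFun_const, specFun_const, Matrix.sub_mulVec,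
      Matrix.sub_mulVec, Matrix.smul_mulVec, Matrix.smul_mulVec, Matrix.one_mulVec,
      Matrix.one_mulVec] at h
    simpa using h
  have hχ : ∀ s, 0 < s → |s * χ s| ≤ 2 * μ / t₀ ^ 2 + μ ^ 2 / t₀ + μ ^ 3 := by
    intro s hs
    have h1 : |μ * (s * φ s)| ≤ 2 * μ / t₀ ^ 2 := by
      rw [abs_of_nonneg (mul_nonneg hμ.le (mul_nonneg hs.le (hφ0 s hs.le)))]
      calc μ * (s * φ s) ≤ μ * (2 / t₀ ^ 2) :=
            mul_le_mul_of_nonneg_left (sq_mul_exp_neg_le ht₀ ht hs.le) hμ.le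
        _ = 2 * μ / t₀ ^ 2 := by ring
    have h2 : |s * ((φ s - φ μ) / (s - μ))| ≤ 1 / t₀ + μ := by
      rcases eq_or_ne s μ with rfl | hne
      · simp only [sub_self, div_zero, mul_zero, abs_zero]
        positivity
      · have hsm : s - μ ≠ 0 := sub_ne_zero.mpr hne
        have he : s * ((φ s - φ μ) / (s - μ)) = (φ s - φ μ) + μ * ((φ s - φ μ) / (s - μ)) := by
          field_simp
          ring
        have ha : |φ s - φ μ| ≤ 1 / t₀ := by
          rw [abs_le]
          constructor <;> linarith [hφ0 s hs.le, hφ1 s hs.le, hφ0 μ hμ.le, hφ1 μ hμ.le]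
        have hb : |μ * ((φ s - φ μ) / (s - μ))| ≤ μ := by
          rw [abs_mul, abs_of_pos hμ, abs_div]
          refine mul_le_of_le_one_right hμ.le ?_
          rw [div_le_one (abs_pos.mpr hsm)]
          exact abs_mul_exp_neg_sub_le (ht₀.le.trans ht) hs.le hμ.le
        rw [he]
        exact (abs_add_le _ _).trans (add_le_add ha hb)
    have he : s * χ s = μ * (s * φ s) + μ ^ 2 * (s * ((φ s - φ μ) / (s - μ))) := by
      simp only [hχdef]; ring
    rw [he]
    refine (abs_add_le _ _).trans ?_
    rw [abs_mul (μ ^ 2), abs_of_pos (pow_pos hμ 2)]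
    have h3 := mul_le_mul_of_nonneg_left h2 (pow_pos hμ 2).le
    have h4 : μ ^ 2 * (1 / t₀ + μ) = μ ^ 2 / t₀ + μ ^ 3 := by ring
    linarith
  have hmain := abs_specFun_mulVec_le hH hpos hBH hC hℓ hB hcard
    (c := 2 * μ / t₀ ^ 2 + μ ^ 2 / t₀ + μ ^ 3)
    (by positivity) hχ hδ hrδ x
  have hlast : |μ * φ μ * r x| ≤ μ / t₀ * δ := by
    rw [abs_mul, abs_of_nonneg (mul_nonneg hμ.le (hφ0 μ hμ.le))]
    refine mul_le_mul ?_ (hrδ x) (abs_nonneg _) (by positivity)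
    calc μ * φ μ ≤ μ * (1 / t₀) := mul_le_mul_of_nonneg_left (hφ1 μ hμ.le) hμ.le
      _ = μ / t₀ := by ring
  change |(specFun hH φ).mulVec v x - φ μ * v x| ≤ _
  rw [hid]
  refine (abs_sub _ _).trans ((add_le_add hmain hlast).trans (le_of_eq ?_))
  unfold quasimodeConst
  ring

/-- A finite approximate eigenfunction expansion of the columns of `H⁻¹` yields one of the columns
of `exp (-t H) = H exp (-t H) · H⁻¹`. -/
theorem abs_exp_apply_sub_sum_le (hH : H.IsHermitian) (hpos : ∀ i, 0 < hH.eigenvalues i)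
    (hBH : B * H = 1) {C ℓ : ℝ} (hC : 0 ≤ C) (hℓ : 0 < ℓ) (hB : ∀ x y, |B x y| ≤ C / ℓ)
    (hcard : (Fintype.card ι : ℝ) ≤ 2 * ℓ) {t₀ t δ η : ℝ} (ht₀ : 0 < t₀) (ht : t₀ ≤ t)
    (hδ : 0 ≤ δ) (hη : 0 ≤ η) {N : ℕ} {μ a : ℕ → ℝ} {v : ℕ → ι → ℝ} (hμ : ∀ n, 0 < μ n)
    (hv : ∀ n < N, ∀ x, |B.mulVec (v n) x - v n x / μ n| ≤ δ) {y : ι}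
    (hexp : ∀ x, |ℓ * B x y - ∑ n ∈ Finset.range N, a n * v n x| ≤ η) (x : ι) :
    |ℓ * NormedSpace.exp ((-t) • H) x y
        - ∑ n ∈ Finset.range N, a n * (μ n * Real.exp (-(t * μ n)) * v n x)|
      ≤ (∑ n ∈ Finset.range N, |a n| * quasimodeConst C t₀ (μ n)) * δ
        + 2 * C * (2 / t₀ ^ 2) * η := by
  set F := specFun hH fun s => s * Real.exp (-(t * s)) with hF
  set ρ : ι → ℝ := fun z => ℓ * B z y - ∑ n ∈ Finset.range N, a n * v n z with hρ
  have hE : NormedSpace.exp ((-t) • H) = F * B := by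
    rw [exp_smul_eq_specFun hH, hF, eq_specFun_inv hH hpos hBH, specFun_mul]
    refine specFun_congr hH fun i => ?_
    have := (hpos i).ne'
    field_simp
  have hcol : ℓ * NormedSpace.exp ((-t) • H) x y
      = ∑ n ∈ Finset.range N, a n * F.mulVec (v n) x + F.mulVec ρ x := by
    rw [hE, Matrix.mul_apply, Finset.mul_sum]
    simp only [Matrix.mulVec, dotProduct, Finset.mul_sum]
    rw [Finset.sum_comm, ← Finset.sum_add_distrib]
    refine Finset.sum_congr rfl fun z _ => ?_
    simp only [hρ, mul_sub, Finset.mul_sum]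
    have : ∀ n, a n * (F x z * v n z) = F x z * (a n * v n z) := fun n => by ring
    simp only [this]
    ring
  have hrem : |F.mulVec ρ x| ≤ 2 * C * (2 / t₀ ^ 2) * η := by
    refine abs_specFun_mulVec_le hH hpos hBH hC hℓ hB hcard (by positivity) (fun s hs => ?_)
      hη hexp x
    rw [abs_of_nonneg (mul_nonneg hs.le (mul_nonneg hs.le (Real.exp_pos _).le))]
    exact sq_mul_exp_neg_le ht₀ ht hs.le
  have hsum : |∑ n ∈ Finset.range N, a n * F.mulVec (v n) x
      - ∑ n ∈ Finset.range N, a n * (μ n * Real.exp (-(t * μ n)) * v n x)|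
      ≤ (∑ n ∈ Finset.range N, |a n| * quasimodeConst C t₀ (μ n)) * δ := by
    rw [← Finset.sum_sub_distrib, Finset.sum_mul]
    refine (Finset.abs_sum_le_sum_abs _ _).trans (Finset.sum_le_sum fun n hn => ?_)
    rw [← mul_sub, abs_mul, mul_assoc |a n|]
    exact mul_le_mul_of_nonneg_left (abs_specFun_mulVec_sub_le hH hpos hBH hC hℓ hB hcard ht₀ ht
      (hμ n) hδ (hv n (Finset.mem_range.mp hn)) x) (abs_nonneg _)
  rw [hcol, add_sub_right_comm]
  exact (abs_add_le _ _).trans (add_le_add hsum hrem)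

end Spectral

/-! ### The Green's function of the walk -/

section Green

variable {L : ℕ} {w : ℤ → ℝ≥0}

/-- The resistance `∑_{-L ≤ z < x} 1 / w_z` between the left boundary point `-L` and `x`. -/
noncomputable def resistance (L : ℕ) (w : ℤ → ℝ≥0) (x : ℤ) : ℝ :=
  ∑ z ∈ Finset.Ico (-(L : ℤ)) x, (w z : ℝ)⁻¹

theorem resistance_left (L : ℕ) (w : ℤ → ℝ≥0) : resistance L w (-(L : ℤ)) = 0 := by
  simp [resistance]

theorem resistance_succ {x : ℤ} (hx : -(L : ℤ) ≤ x) :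
    resistance L w (x + 1) = resistance L w x + (w x : ℝ)⁻¹ := by
  unfold resistance
  rw [← Finset.insert_Ico_right_eq_Ico_add_one hx, Finset.sum_insert (by simp), add_comm]

theorem resistance_mono {x y : ℤ} (h : x ≤ y) : resistance L w x ≤ resistance L w y :=
  Finset.sum_le_sum_of_subset_of_nonneg (Finset.Ico_subset_Ico_right h)
    fun z _ _ => inv_nonneg.mpr (w z).coe_nonneg

theorem resistance_nonneg (x : ℤ) : 0 ≤ resistance L w x :=
  Finset.sum_nonneg fun z _ => inv_nonneg.mpr (w z).coe_nonneg

theorem resistance_right_pos (hL : 0 < L) (hw : ∀ z, 0 < w z) : 0 < resistance L w L := by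
  refine Finset.sum_pos (fun z _ => inv_pos.mpr (by exact_mod_cast hw z)) ?_
  exact ⟨0, by simp [hL]⟩

/-- The Green's function of `-L² Δ_{L,w}` at two points of `[-L, L]`; it vanishes if one of them is
`±L`. -/
noncomputable def greenAux (L : ℕ) (w : ℤ → ℝ≥0) (x y : ℤ) : ℝ :=
  resistance L w (min x y) * (resistance L w L - resistance L w (max x y)) /
    resistance L w L / (L : ℝ) ^ 2

/-- The Green's function of the walk as a matrix, the inverse of `-L² Δ_{L,w}`. -/
noncomputable def green (L : ℕ) (w : ℤ → ℝ≥0) : Matrix (box L) (box L) ℝ :=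
  Matrix.of fun x y => greenAux L w x y

/-- The positive operator `-L² Δ_{L,w}`. -/
noncomputable def scaledGenerator (L : ℕ) (w : ℤ → ℝ≥0) : Matrix (box L) (box L) ℝ :=
  (-(L : ℝ) ^ 2) • generator L w

theorem mem_box_iff {x : ℤ} : x ∈ box L ↔ -(L : ℤ) < x ∧ x < L := Finset.mem_Ioo

/-- A function on `[-L, L]` that vanishes at `±L` is the extension by zero of its restriction to
the box, at every point of `[-L, L]`. -/
theorem zeroExt_restrict {g : ℤ → ℝ} (h1 : g (-(L : ℤ)) = 0) (h2 : g L = 0) {z : ℤ}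
    (hz1 : -(L : ℤ) ≤ z) (hz2 : z ≤ L) : zeroExt (fun x : box L => g x) z = g z := by
  unfold zeroExt
  split_ifs with h
  · rfl
  · rw [mem_box_iff, not_and_or, not_lt, not_lt] at h
    rcases h with h | h
    · rw [le_antisymm h hz1, h1]
    · rw [le_antisymm hz2 h, h2]

theorem generator_mulVec_restrict {g : ℤ → ℝ} (h1 : g (-(L : ℤ)) = 0) (h2 : g L = 0) (x : box L) :
    (generator L w).mulVec (fun x : box L => g x) x
      = w x * (g (x + 1) - g x) + w (x - 1) * (g (x - 1) - g x) := by
  obtain ⟨hx1, hx2⟩ := mem_box_iff.mp x.2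
  rw [generator_mulVec, zeroExt_restrict h1 h2 (by lia) (by lia),
    zeroExt_restrict h1 h2 (by lia) (by lia)]

theorem scaledGenerator_mul_green (hL : 0 < L) (hw : ∀ z, 0 < w z) :
    scaledGenerator L w * green L w = 1 := by
  have hT := (resistance_right_pos hL hw).ne'
  have hL' : (L : ℝ) ≠ 0 := by exact_mod_cast hL.ne'
  ext x y
  obtain ⟨hx1, hx2⟩ := mem_box_iff.mp x.2
  obtain ⟨hy1, hy2⟩ := mem_box_iff.mp y.2
  have hl : greenAux L w (-(L : ℤ)) y = 0 := by
    rw [greenAux, min_eq_left hy1.le, resistance_left]; simp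
  have hr : greenAux L w L y = 0 := by
    rw [greenAux, max_eq_left hy2.le]; simp
  have hcol : (scaledGenerator L w * green L w) x y
      = -(L : ℝ) ^ 2 * (generator L w).mulVec (fun z : box L => greenAux L w z y) x := by
    rw [scaledGenerator, Matrix.smul_mul, Matrix.smul_apply, smul_eq_mul, Matrix.mul_apply]
    rfl
  rw [hcol, generator_mulVec_restrict (g := fun z => greenAux L w z y) hl hr]
  have hwx : (w x : ℝ) ≠ 0 := by exact_mod_cast (hw x).ne'
  have hwx' : (w (x - 1) : ℝ) ≠ 0 := by exact_mod_cast (hw (x - 1)).ne'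
  have hs1 : resistance L w (x + 1) = resistance L w x + (w x : ℝ)⁻¹ := resistance_succ hx1.le
  have hs2 : resistance L w (x - 1) = resistance L w x - (w (x - 1) : ℝ)⁻¹ := by
    have := resistance_succ (L := L) (w := w) (x := (x : ℤ) - 1) (by lia)
    rw [sub_add_cancel] at this
    linarith
  rcases lt_trichotomy (x : ℤ) y with h | h | h
  · rw [Matrix.one_apply_ne fun he => h.ne (congrArg _ he)]
    simp only [greenAux]
    rw [min_eq_left (by lia : (x : ℤ) + 1 ≤ y), max_eq_right (by lia : (x : ℤ) + 1 ≤ y),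
      min_eq_left h.le, max_eq_right h.le, min_eq_left (by lia : (x : ℤ) - 1 ≤ y),
      max_eq_right (by lia : (x : ℤ) - 1 ≤ y), hs1, hs2]
    field_simp
    ring
  · rw [show x = y from Subtype.ext h, Matrix.one_apply_eq]
    rw [show x = y from Subtype.ext h] at hs1 hs2 hwx hwx'
    simp only [greenAux]
    rw [min_eq_right (by lia : (y : ℤ) ≤ y + 1), max_eq_left (by lia : (y : ℤ) ≤ y + 1),
      min_self, max_self, min_eq_left (by lia : (y : ℤ) - 1 ≤ y),
      max_eq_right (by lia : (y : ℤ) - 1 ≤ y), hs1, hs2]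
    field_simp
    ring
  · rw [Matrix.one_apply_ne fun he => h.ne' (congrArg _ he)]
    simp only [greenAux]
    rw [min_eq_right (by lia : (y : ℤ) ≤ x + 1), max_eq_left (by lia : (y : ℤ) ≤ x + 1),
      min_eq_right h.le, max_eq_left h.le, min_eq_right (by lia : (y : ℤ) ≤ x - 1),
      max_eq_left (by lia : (y : ℤ) ≤ x - 1), hs1, hs2]
    field_simp
    ring

theorem green_mul_scaledGenerator (hL : 0 < L) (hw : ∀ z, 0 < w z) :
    green L w * scaledGenerator L w = 1 :=
  mul_eq_one_comm.mp (scaledGenerator_mul_green hL hw)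

theorem isHermitian_scaledGenerator (L : ℕ) (w : ℤ → ℝ≥0) : (scaledGenerator L w).IsHermitian := by
  ext x y
  simp only [scaledGenerator, generator, Matrix.conjTranspose_apply, Matrix.smul_apply,
    Matrix.of_apply, star_trivial]
  congr 1
  by_cases h1 : (x : ℤ) = y + 1
  · simp [h1, show ¬ ((y : ℤ) = y + 1 + 1) by lia]
  by_cases h2 : (x : ℤ) = y - 1
  · simp [h2, show ¬ ((y : ℤ) - 1 = y + 1) by lia]
  by_cases h3 : (x : ℤ) = y
  · simp [h3]
  · rw [if_neg h1, if_neg h2, if_neg h3, if_neg (by lia), if_neg (by lia), if_neg (by lia)]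

/-- Eigenvalues are non-negative by the maximum principle at a maximum of the modulus of an
eigenvector, and non-zero because the Green's function is an inverse. -/
theorem eigenvalues_scaledGenerator_pos (hL : 0 < L) (hw : ∀ z, 0 < w z) (i : box L) :
    0 < (isHermitian_scaledGenerator L w).eigenvalues i := by
  set hH := isHermitian_scaledGenerator L w
  set u : box L → ℝ := (hH.eigenvectorBasis i).ofLp with hu
  have heig : (scaledGenerator L w).mulVec u = hH.eigenvalues i • u :=
    hH.mulVec_eigenvectorBasis i
  have hu0 : u ≠ 0 := by
    intro h
    refine hH.eigenvectorBasis.toBasis.ne_zero i ?_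
    ext x
    simpa using congrFun h x
  refine lt_of_le_of_ne ?_ fun h0 => ?_
  · have : Nonempty (box L) := ⟨i⟩
    obtain ⟨x, hx⟩ := Finite.exists_max fun x => |u x|
    have hxpos : 0 < |u x| := by
      by_contra hle
      exact hu0 (funext fun z => abs_nonpos_iff.mp ((hx z).trans (not_lt.mp hle)))
    have hext : ∀ z, u x * zeroExt u z ≤ u x ^ 2 := by
      intro z
      have hz : |zeroExt u z| ≤ |u x| := by
        unfold zeroExt
        split_ifs with h
        · exact hx _
        · simp
      calc u x * zeroExt u z ≤ |u x| * |zeroExt u z| := by rw [← abs_mul]; exact le_abs_self _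
        _ ≤ |u x| * |u x| := mul_le_mul_of_nonneg_left hz (abs_nonneg _)
        _ = u x ^ 2 := by rw [← sq, sq_abs]
    have hev : -(L : ℝ) ^ 2 * (w x * (zeroExt u (x + 1) - u x)
        + w (x - 1) * (zeroExt u (x - 1) - u x)) = hH.eigenvalues i * u x := by
      rw [← generator_mulVec]
      have := congrFun heig x
      simpa only [scaledGenerator, Matrix.smul_mulVec, Pi.smul_apply, smul_eq_mul] using this
    have h1 := mul_le_mul_of_nonneg_left (hext (x + 1)) (w x).coe_nonneg
    have h2 := mul_le_mul_of_nonneg_left (hext (x - 1)) (w (x - 1)).coe_nonneg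
    have h3 : 0 ≤ (w x * (u x ^ 2 - u x * zeroExt u (x + 1))
        + w (x - 1) * (u x ^ 2 - u x * zeroExt u (x - 1))) := by linarith
    have h4 : hH.eigenvalues i * u x ^ 2 = (L : ℝ) ^ 2 * (w x * (u x ^ 2 - u x * zeroExt u (x + 1))
        + w (x - 1) * (u x ^ 2 - u x * zeroExt u (x - 1))) := by
      rw [sq (u x), ← mul_assoc, ← hev]; ring
    have h5 : 0 ≤ hH.eigenvalues i * u x ^ 2 := h4 ▸ mul_nonneg (sq_nonneg _) h3
    exact nonneg_of_mul_nonneg_left h5 (by rw [← sq_abs]; positivity)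
  · refine hu0 ?_
    rw [← Matrix.one_mulVec u, ← green_mul_scaledGenerator hL hw, ← Matrix.mulVec_mulVec, heig,
      ← h0, zero_smul, Matrix.mulVec_zero]

theorem transition_eq_exp (w : ℤ → ℝ≥0) (L : ℕ) (t : ℝ) :
    transition L w ((L : ℝ) ^ 2 * t) = NormedSpace.exp ((-t) • scaledGenerator L w) := by
  rw [transition, scaledGenerator, smul_smul]
  congr 2
  ring

theorem mul_green_apply (hL : 0 < L) (x y : box L) :
    (L : ℝ) * green L w x y = resistance L w (min x y) / L *
      (resistance L w L / L - resistance L w (max x y) / L) / (resistance L w L / L) := by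
  have hL' : (L : ℝ) ≠ 0 := by exact_mod_cast hL.ne'
  simp only [green, Matrix.of_apply, greenAux]
  rcases eq_or_ne (resistance L w L) 0 with h | h
  · simp [h]
  · field_simp

theorem green_nonneg (x y : box L) : 0 ≤ green L w x y := by
  have hy := (mem_box_iff.mp y.2).2
  have hx := (mem_box_iff.mp x.2).2
  simp only [green, Matrix.of_apply, greenAux]
  refine div_nonneg (div_nonneg (mul_nonneg (resistance_nonneg _) (sub_nonneg.mpr
    (resistance_mono (max_le hx.le hy.le)))) (resistance_nonneg _)) (sq_nonneg _)

theorem mul_green_le (hL : 0 < L) (hw : ∀ z, 0 < w z) (x y : box L) :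
    (L : ℝ) * green L w x y ≤ resistance L w L / L := by
  have hT := resistance_right_pos hL hw
  have hL' : (0 : ℝ) < L := by exact_mod_cast hL
  have hx := (mem_box_iff.mp x.2).2
  rw [mul_green_apply hL, div_le_iff₀ (div_pos hT hL')]
  refine mul_le_mul ?_ (sub_le_self _ (div_nonneg (resistance_nonneg _) hL'.le))
    (sub_nonneg.mpr ?_) (div_pos hT hL').le
  · exact div_le_div_of_nonneg_right (resistance_mono ((min_le_left _ _).trans hx.le)) hL'.le
  · exact div_le_div_of_nonneg_right
      (resistance_mono (max_le hx.le (mem_box_iff.mp y.2).2.le)) hL'.le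

/-- The scaled Green's function depends on the environment only through the scaled resistances. -/
theorem abs_mul_green_sub_le {w' : ℤ → ℝ≥0} (hL : 0 < L) (hw : ∀ z, 0 < w z)
    (hw' : ∀ z, 0 < w' z) {δ : ℝ}
    (hδ : ∀ x : ℤ, -(L : ℤ) ≤ x → x ≤ L → |resistance L w x / L - resistance L w' x / L| ≤ δ)
    (x y : box L) : |(L : ℝ) * green L w x y - L * green L w' x y| ≤ 4 * δ := by
  have hT := resistance_right_pos hL hw
  have hT' := resistance_right_pos hL hw'
  have hL' : (0 : ℝ) < L := by exact_mod_cast hL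
  obtain ⟨hx1, hx2⟩ := mem_box_iff.mp x.2
  obtain ⟨hy1, hy2⟩ := mem_box_iff.mp y.2
  have ha := hδ (min x y) (by lia) (by lia)
  have hb := hδ (max x y) (by lia) (by lia)
  have hτ := hδ L (by lia) le_rfl
  rw [mul_green_apply hL, mul_green_apply hL]
  have a0 : 0 ≤ resistance L w (min x y) / L := div_nonneg (resistance_nonneg _) hL'.le
  have aτ : resistance L w (min x y) / L ≤ resistance L w L / L :=
    div_le_div_of_nonneg_right (resistance_mono (by lia)) hL'.le
  have b0' : 0 ≤ resistance L w' (max x y) / L := div_nonneg (resistance_nonneg _) hL'.le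
  have bτ' : resistance L w' (max x y) / L ≤ resistance L w' L / L :=
    div_le_div_of_nonneg_right (resistance_mono (by lia)) hL'.le
  have τ0 : 0 < resistance L w L / L := div_pos hT hL'
  have τ0' : 0 < resistance L w' L / L := div_pos hT' hL'
  generalize resistance L w (min x y) / L = a at *
  generalize resistance L w' (min x y) / L = a' at *
  generalize resistance L w (max x y) / L = b at *
  generalize resistance L w' (max x y) / L = b' at *
  generalize resistance L w L / L = τ at *
  generalize resistance L w' L / L = τ' at *
  -- `a (1 - b / τ) - a' (1 - b' / τ')`, with both `a / τ` and `b' / τ'` in `[0, 1]`.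
  have he : a * (τ - b) / τ - a' * (τ' - b') / τ'
      = (a - a') * (1 - b' / τ') - a / τ * (b - b') + a / τ * (b' / τ') * (τ - τ') := by
    field_simp
    ring
  have hp0 : 0 ≤ a / τ := div_nonneg a0 τ0.le
  have hp1 : a / τ ≤ 1 := (div_le_one τ0).mpr aτ
  have hq0 : 0 ≤ b' / τ' := div_nonneg b0' τ0'.le
  have hq1 : b' / τ' ≤ 1 := (div_le_one τ0').mpr bτ'
  generalize a / τ = p at *
  generalize b' / τ' = q at *
  have hδ0 : 0 ≤ δ := (abs_nonneg _).trans ha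
  have hm : ∀ {k e : ℝ}, 0 ≤ k → k ≤ 1 → |e| ≤ δ → |k * e| ≤ δ := fun hk hk1 he => by
    rw [abs_mul, abs_of_nonneg hk]
    exact (mul_le_of_le_one_left (abs_nonneg _) hk1).trans he
  have t1 := hm (sub_nonneg.mpr hq1) (by linarith) ha
  have t2 := hm hp0 hp1 hb
  have t3 := hm (mul_nonneg hp0 hq0) (mul_le_one₀ hp1 hq0 hq1) hτ
  rw [he, mul_comm (a - a')]
  calc _ ≤ |(1 - q) * (a - a') - p * (b - b')| + |p * q * (τ - τ')| := abs_add_le _ _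
    _ ≤ |(1 - q) * (a - a')| + |p * (b - b')| + |p * q * (τ - τ')| :=
        add_le_add_left (abs_sub _ _) _
    _ ≤ 4 * δ := by linarith

end Green

/-! ### The homogeneous environment -/

section Homogeneous

variable {L : ℕ} {κ : ℝ≥0}

theorem resistance_const_div (hL : 0 < L) {x : ℤ} (hx : -(L : ℤ) ≤ x) :
    resistance L (fun _ => κ) x / L = ((x : ℝ) / L + 1) / κ := by
  have hL' : (L : ℝ) ≠ 0 := by exact_mod_cast hL.ne'
  have hcard : ((Finset.Ico (-(L : ℤ)) x).card : ℝ) = x + L := by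
    rw [Int.card_Ico, ← Int.cast_natCast, Int.toNat_of_nonneg (by lia)]
    push_cast
    ring
  rw [resistance, Finset.sum_const, nsmul_eq_mul, hcard]
  field_simp

/-- The Green's function of `-d²/dr²` on `(-1,1)` with Dirichlet boundary condition. -/
noncomputable def greenFun (r s : ℝ) : ℝ := (min r s + 1) * (1 - max r s) / 2

theorem mul_green_const (hL : 0 < L) (hκ : 0 < κ) (x y : box L) :
    (L : ℝ) * green L (fun _ => κ) x y = greenFun ((x : ℤ) / L) ((y : ℤ) / L) / κ := by
  have hL' : (0 : ℝ) < L := by exact_mod_cast hL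
  have hκ' : (κ : ℝ) ≠ 0 := by exact_mod_cast hκ.ne'
  obtain ⟨hx1, hx2⟩ := mem_box_iff.mp x.2
  obtain ⟨hy1, hy2⟩ := mem_box_iff.mp y.2
  have hmin : ((min (x : ℤ) y : ℤ) : ℝ) / L = min ((x : ℤ) / (L : ℝ)) ((y : ℤ) / L) := by
    rw [Int.cast_min, min_div_div_right hL'.le]
  have hmax : ((max (x : ℤ) y : ℤ) : ℝ) / L = max ((x : ℤ) / (L : ℝ)) ((y : ℤ) / L) := by
    rw [Int.cast_max, max_div_div_right hL'.le]
  rw [mul_green_apply hL, resistance_const_div hL (by lia), resistance_const_div hL (by lia),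
    resistance_const_div hL (by lia), hmin, hmax, greenFun]
  have : ((L : ℤ) : ℝ) / L = 1 := by rw [Int.cast_natCast, div_self hL'.ne']
  rw [this]
  field_simp
  ring

/-- The eigenvalue of the discrete sine vector `x ↦ mode n (x / L)`. -/
noncomputable def discreteEigenvalue (κ : ℝ) (L n : ℕ) : ℝ :=
  κ * (L ^ 2 * (2 * (1 - Real.cos (n * Real.pi / 2 / L))))

theorem scaledGenerator_const_mulVec_mode (hL : 0 < L) (n : ℕ) (x : box L) :
    (scaledGenerator L fun _ => κ).mulVec (fun x : box L => mode n ((x : ℤ) / L)) x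
      = discreteEigenvalue κ L n * mode n ((x : ℤ) / L) := by
  have hL' : (L : ℝ) ≠ 0 := by exact_mod_cast hL.ne'
  obtain ⟨hb1, hb2⟩ := mode_boundary n
  have h1 : mode n (((-(L : ℤ) : ℤ) : ℝ) / L) = 0 := by
    rw [Int.cast_neg, Int.cast_natCast, neg_div, div_self hL', hb1]
  have h2 : mode n (((L : ℤ) : ℝ) / L) = 0 := by rw [Int.cast_natCast, div_self hL', hb2]
  rw [scaledGenerator, Matrix.smul_mulVec, Pi.smul_apply,
    generator_mulVec_restrict (g := fun z => mode n ((z : ℝ) / L)) h1 h2]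
  have hp : (n : ℝ) * Real.pi / 2 * ((((x : ℤ) + 1 : ℤ) : ℝ) / L + 1)
      = n * Real.pi / 2 * ((x : ℤ) / L + 1) + n * Real.pi / 2 / L := by
    push_cast; field_simp; ring
  have hm : (n : ℝ) * Real.pi / 2 * ((((x : ℤ) - 1 : ℤ) : ℝ) / L + 1)
      = n * Real.pi / 2 * ((x : ℤ) / L + 1) - n * Real.pi / 2 / L := by
    push_cast; field_simp; ring
  simp only [mode, smul_eq_mul, discreteEigenvalue]
  rw [hp, hm, Real.sin_add, Real.sin_sub]
  ring

theorem tendsto_discreteEigenvalue (κ : ℝ) (n : ℕ) :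
    Tendsto (fun L : ℕ => discreteEigenvalue κ L n) atTop (𝓝 (κ * eigenvalue n)) := by
  have h0 : Tendsto (fun L : ℕ => n * Real.pi / 2 / 2 / (L : ℝ)) atTop (𝓝 0) :=
    tendsto_const_div_atTop_nhds_zero_nat _
  have h1 : Tendsto
      (fun L : ℕ => κ * (n * Real.pi / 2 * Real.sinc (n * Real.pi / 2 / 2 / (L : ℝ))) ^ 2)
      atTop (𝓝 (κ * eigenvalue n)) := by
    have := (Real.continuous_sinc.tendsto 0).comp h0
    rw [Real.sinc_zero] at this
    simpa [eigenvalue] using ((this.const_mul (n * Real.pi / 2)).pow 2).const_mul κ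
  refine h1.congr' ?_
  filter_upwards [eventually_gt_atTop 0] with L hL
  have hL' : (L : ℝ) ≠ 0 := by exact_mod_cast hL.ne'
  rcases Nat.eq_zero_or_pos n with rfl | hn
  · simp [discreteEigenvalue]
  have hn' : (n : ℝ) ≠ 0 := by exact_mod_cast hn.ne'
  have hne : n * Real.pi / 2 / 2 / (L : ℝ) ≠ 0 := by positivity
  have hcos : Real.cos (n * Real.pi / 2 / L) = 1 - 2 * Real.sin (n * Real.pi / 2 / 2 / L) ^ 2 := by
    have : n * Real.pi / 2 / (L : ℝ) = 2 * (n * Real.pi / 2 / 2 / L) := by ring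
    rw [this, Real.cos_two_mul, Real.cos_sq']
    ring
  rw [Real.sinc_of_ne_zero hne, discreteEigenvalue, hcos]
  field_simp
  ring

theorem eigenvalue_pos {n : ℕ} (hn : 0 < n) : 0 < eigenvalue n := by
  have : (0 : ℝ) < n := by exact_mod_cast hn
  unfold eigenvalue
  positivity

/-- The eigenfunction expansion of the Green's function of `-d²/dr²`. -/
theorem hasSum_greenFun {r s : ℝ} (hr : r ∈ Set.Icc (-1 : ℝ) 1) (hs : s ∈ Set.Icc (-1 : ℝ) 1) :
    HasSum (fun n : ℕ => 1 / eigenvalue (n + 1) * (mode (n + 1) r * mode (n + 1) s))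
      (greenFun r s) := by
  wlog hrs : s ≤ r generalizing r s
  · have := this hs hr (le_of_not_ge hrs)
    simpa only [greenFun, min_comm s r, max_comm s r, mul_comm (mode _ s)] using this
  have hcos : ∀ x ∈ Set.Icc (0 : ℝ) 1, HasSum
      (fun n : ℕ => 1 / (n : ℝ) ^ 2 * Real.cos (2 * Real.pi * n * x))
      (Real.pi ^ 2 * (x ^ 2 - x + 1 / 6)) := by
    intro x hx
    have h := hasSum_one_div_nat_pow_mul_cos one_ne_zero hx
    have hb : ((Polynomial.bernoulli (2 * 1)).map (algebraMap ℚ ℝ)).eval x = x ^ 2 - x + 1 / 6 := by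
      simp only [Polynomial.bernoulli, mul_one, Finset.sum_range_succ, Finset.sum_range_zero]
      simp [bernoulli_two, bernoulli_one, -map_one, Polynomial.map_monomial]
      ring
    rw [hb] at h
    convert h using 1
    simp
    ring
  have h1 := hcos ((r - s) / 4) ⟨by linarith, by linarith [hr.2, hs.1]⟩
  have h2 := hcos ((r + s + 2) / 4) ⟨by linarith [hr.1, hs.1], by linarith [hr.2, hs.2]⟩
  have h3 := (h1.sub h2).mul_left (2 / Real.pi ^ 2)
  rw [← hasSum_nat_add_iff' 1] at h3
  have hterm : ∀ n : ℕ, 1 / eigenvalue (n + 1) * (mode (n + 1) r * mode (n + 1) s)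
      = 2 / Real.pi ^ 2 * (1 / ((n + 1 : ℕ) : ℝ) ^ 2 *
          Real.cos (2 * Real.pi * ((n + 1 : ℕ) : ℝ) * ((r - s) / 4))
        - 1 / ((n + 1 : ℕ) : ℝ) ^ 2 *
          Real.cos (2 * Real.pi * ((n + 1 : ℕ) : ℝ) * ((r + s + 2) / 4))) := by
    intro n
    have hc1 : 2 * Real.pi * ((n + 1 : ℕ) : ℝ) * ((r - s) / 4)
        = (n + 1 : ℕ) * Real.pi / 2 * (r + 1) - (n + 1 : ℕ) * Real.pi / 2 * (s + 1) := by ring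
    have hc2 : 2 * Real.pi * ((n + 1 : ℕ) : ℝ) * ((r + s + 2) / 4)
        = (n + 1 : ℕ) * Real.pi / 2 * (r + 1) + (n + 1 : ℕ) * Real.pi / 2 * (s + 1) := by ring
    rw [hc1, hc2, Real.cos_sub, Real.cos_add]
    unfold mode eigenvalue
    field_simp
    ring
  have hval : greenFun r s = (s + 1) * (1 - r) / 2 := by
    rw [greenFun.eq_1, min_eq_right hrs, max_eq_left hrs]
  simp only [hterm, hval]
  refine (congrArg (HasSum _ · _) ?_).mpr h3
  have := Real.pi_ne_zero
  simp
  field_simp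
  ring

theorem summable_inv_eigenvalue : Summable fun n : ℕ => 1 / eigenvalue (n + 1) := by
  have h : Summable fun n : ℕ => 1 / (n : ℝ) ^ 2 := Real.summable_one_div_nat_pow.mpr one_lt_two
  refine (((summable_nat_add_iff 1).mpr h).mul_left (4 / Real.pi ^ 2)).congr fun n => ?_
  have hn : ((n : ℝ) + 1) ≠ 0 := by positivity
  simp only [eigenvalue]
  push_cast
  field_simp
  norm_num

end Homogeneous

/-! ### Uniform convergence of the rescaled transition kernels -/

section Kernel

variable {w : ℤ → ℝ≥0} {κ : ℝ}

/-- The rescaled resistance of the environment converges to that of the homogeneous medium with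
conductivity `κ`, uniformly on `[-1,1]`. -/
def ResistanceConverges (w : ℤ → ℝ≥0) (κ : ℝ) : Prop :=
  ∀ ε : ℝ, 0 < ε → ∀ᶠ L : ℕ in atTop, ∀ x : ℤ, -(L : ℤ) ≤ x → x ≤ L →
    |resistance L w x / L - ((x : ℝ) / L + 1) / κ| ≤ ε

theorem exists_pos_mul_le {A e : ℝ} (hA : 0 ≤ A) (he : 0 < e) : ∃ δ : ℝ, 0 < δ ∧ A * δ ≤ e := by
  refine ⟨e / (A + 1), by positivity, ?_⟩
  rw [← mul_div_assoc, div_le_iff₀ (by positivity)]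
  nlinarith

theorem card_box_le (L : ℕ) : (Fintype.card (box L) : ℝ) ≤ 2 * L := by
  rw [Fintype.card_coe, Int.card_Ioo]
  exact_mod_cast (by lia : (((L : ℤ) - -(L : ℤ) - 1).toNat) ≤ 2 * L)

theorem abs_sub_sum_range_le {f b : ℕ → ℝ} {a : ℝ} (hf : HasSum f a) (hb : Summable b)
    (hfb : ∀ n, |f n| ≤ b n) (N : ℕ) :
    |a - ∑ n ∈ Finset.range N, f n| ≤ ∑' n, b (n + N) := by
  rw [← ((hasSum_nat_add_iff' N).mpr hf).tsum_eq]
  exact tsum_of_norm_bounded (f := fun n => f (n + N)) ((summable_nat_add_iff N).mpr hb).hasSum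
    fun n => hfb (n + N)

theorem abs_mul_green_sub_const_le (hκ : 0 < κ) {L : ℕ} (hL : 0 < L) (hw : ∀ z, 0 < w z) {δ : ℝ}
    (hδ : ∀ x : ℤ, -(L : ℤ) ≤ x → x ≤ L → |resistance L w x / L - ((x : ℝ) / L + 1) / κ| ≤ δ)
    (x y : box L) :
    |(L : ℝ) * green L w x y - L * green L (fun _ => κ.toNNReal) x y| ≤ 4 * δ := by
  refine abs_mul_green_sub_le hL hw (fun _ => Real.toNNReal_pos.mpr hκ) (fun z hz1 hz2 => ?_) x y
  rw [resistance_const_div hL hz1, Real.coe_toNNReal κ hκ.le]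
  exact hδ z hz1 hz2

/-- The restrictions to the lattice of the Dirichlet eigenfunctions are approximate eigenvectors of
the Green's function: they are exact ones in the homogeneous environment. -/
theorem eventually_abs_green_mulVec_mode_sub_le (hκ : 0 < κ) (hw : ∀ z, 0 < w z)
    (hres : ResistanceConverges w κ) (n : ℕ) {δ : ℝ} (hδ : 0 < δ) :
    ∀ᶠ L : ℕ in atTop, ∀ x : box L,
      |(green L w).mulVec (fun x : box L => mode (n + 1) ((x : ℤ) / L)) x
        - mode (n + 1) ((x : ℤ) / L) / (κ * eigenvalue (n + 1))| ≤ δ := by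
  have hμ : 0 < κ * eigenvalue (n + 1) := mul_pos hκ (eigenvalue_pos n.succ_pos)
  have hν := tendsto_discreteEigenvalue κ (n + 1)
  have hinv : ∀ᶠ L : ℕ in atTop,
      |(discreteEigenvalue κ L (n + 1))⁻¹ - (κ * eigenvalue (n + 1))⁻¹| ≤ δ / 2 := by
    have := Metric.tendsto_nhds.mp (hν.inv₀ hμ.ne') (δ / 2) (half_pos hδ)
    exact this.mono fun L h => (Real.dist_eq _ _ ▸ h).le
  filter_upwards [hinv, hν.eventually (lt_mem_nhds hμ), hres (δ / 16) (by positivity),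
    eventually_gt_atTop 0] with L h1 h2 h3 hL x
  have hL' : (0 : ℝ) < L := by exact_mod_cast hL
  set v : box L → ℝ := fun x => mode (n + 1) ((x : ℤ) / L) with hv
  have hv1 : ∀ x, |v x| ≤ 1 := fun x => abs_mode_le _ _
  set B := green L w
  set B₀ := green L fun _ => κ.toNNReal with hB₀
  have hB₀v : B₀.mulVec v = (discreteEigenvalue κ L (n + 1))⁻¹ • v := by
    have hHv : (scaledGenerator L fun _ => κ.toNNReal).mulVec v
        = discreteEigenvalue κ L (n + 1) • v := by
      ext z
      rw [hv, scaledGenerator_const_mulVec_mode hL, Real.coe_toNNReal κ hκ.le]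
      rfl
    have h := congrArg B₀.mulVec hHv
    rw [Matrix.mulVec_mulVec, green_mul_scaledGenerator hL fun _ => Real.toNNReal_pos.mpr hκ,
      Matrix.one_mulVec, Matrix.mulVec_smul] at h
    conv_rhs => rw [h, smul_smul, inv_mul_cancel₀ h2.ne', one_smul]
  have hdiff : |B.mulVec v x - B₀.mulVec v x| ≤ δ / 2 := by
    rw [← Pi.sub_apply, ← Matrix.sub_mulVec]
    calc |(B - B₀).mulVec v x| ≤ ∑ y, |(B - B₀) x y * v y| :=
          Finset.abs_sum_le_sum_abs (fun y => (B - B₀) x y * v y) Finset.univ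
      _ ≤ ∑ _y : box L, 4 * (δ / 16) / L := Finset.sum_le_sum fun y _ => by
          rw [abs_mul, Matrix.sub_apply]
          refine (mul_le_of_le_one_right (abs_nonneg _) (hv1 y)).trans ?_
          have h := abs_mul_green_sub_const_le hκ hL hw h3 x y
          rw [← mul_sub, abs_mul, abs_of_pos hL', mul_comm] at h
          exact (le_div_iff₀ hL').mpr h
      _ = Fintype.card (box L) * (4 * (δ / 16) / L) := by simp
      _ ≤ 2 * L * (4 * (δ / 16) / L) :=
          mul_le_mul_of_nonneg_right (card_box_le L) (by positivity)
      _ = δ / 2 := by field_simp; norm_num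
  have hsecond : |B₀.mulVec v x - v x / (κ * eigenvalue (n + 1))| ≤ δ / 2 := by
    rw [hB₀v, Pi.smul_apply, smul_eq_mul, div_eq_mul_inv, mul_comm (v x), ← sub_mul, abs_mul]
    exact (mul_le_of_le_one_right (abs_nonneg _) (hv1 x)).trans h1
  calc |B.mulVec v x - v x / (κ * eigenvalue (n + 1))|
      ≤ |B.mulVec v x - B₀.mulVec v x| + |B₀.mulVec v x - v x / (κ * eigenvalue (n + 1))| :=
        abs_sub_le _ _ _
    _ ≤ δ := by linarith

theorem intCast_div_mem_Icc {L : ℕ} (x : box L) : ((x : ℤ) : ℝ) / L ∈ Set.Icc (-1 : ℝ) 1 := by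
  obtain ⟨h1, h2⟩ := mem_box_iff.mp x.2
  have hL : (0 : ℝ) < L := by exact_mod_cast (by lia : 0 < L)
  have h1' : -(L : ℝ) ≤ (x : ℤ) := by exact_mod_cast h1.le
  have h2' : ((x : ℤ) : ℝ) ≤ L := by exact_mod_cast h2.le
  exact ⟨by rw [le_div_iff₀ hL]; linarith, by rw [div_le_iff₀ hL]; linarith⟩

theorem abs_mode_mul_mode_le (n : ℕ) (r s : ℝ) : |mode n r * mode n s| ≤ 1 := by
  rw [abs_mul]
  exact mul_le_one₀ (abs_mode_le _ _) (abs_nonneg _) (abs_mode_le _ _)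

theorem exp_eigenvalue_le (hκ : 0 < κ) {t₀ t : ℝ} (ht : t₀ ≤ t) (n : ℕ) :
    Real.exp (-(t * κ * eigenvalue (n + 1))) ≤ Real.exp (-(t₀ * κ * eigenvalue (n + 1))) := by
  refine Real.exp_le_exp.mpr (neg_le_neg ?_)
  exact mul_le_mul_of_nonneg_right (mul_le_mul_of_nonneg_right ht hκ.le)
    (eigenvalue_pos n.succ_pos).le

theorem abs_heatKernel_sub_sum_le (hκ : 0 < κ) {t₀ t : ℝ} (ht₀ : 0 < t₀) (ht : t₀ ≤ t) (N : ℕ)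
    (r s : ℝ) :
    |heatKernel κ t r s - ∑ n ∈ Finset.range N, Real.exp (-(t * κ * eigenvalue (n + 1))) *
      (mode (n + 1) r * mode (n + 1) s)|
      ≤ ∑' n, Real.exp (-(t₀ * κ * eigenvalue (n + N + 1))) := by
  refine abs_sub_sum_range_le (summable_heatKernel hκ (ht₀.trans_le ht) r s).hasSum
    (summable_exp hκ ht₀) (fun n => ?_) N
  rw [abs_mul, Real.abs_exp]
  exact (mul_le_of_le_one_right (Real.exp_pos _).le (abs_mode_mul_mode_le _ _ _)).trans
    (exp_eigenvalue_le hκ ht n)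

/-- Convergence of the rescaled transition probabilities at lattice points. -/
theorem eventually_abs_transition_sub_heatKernel_le (hκ : 0 < κ) (hw : ∀ z, 0 < w z)
    (hres : ResistanceConverges w κ) {t₀ : ℝ} (ht₀ : 0 < t₀) {ε : ℝ} (hε : 0 < ε) :
    ∀ᶠ L : ℕ in atTop, ∀ t : ℝ, t₀ ≤ t → ∀ x y : box L,
      |(L : ℝ) * transition L w ((L : ℝ) ^ 2 * t) x y
        - heatKernel κ t ((x : ℤ) / L) ((y : ℤ) / L)| ≤ ε := by
  set C : ℝ := 3 / κ with hCdef
  have hC : 0 < C := by positivity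
  set μ : ℕ → ℝ := fun n => κ * eigenvalue (n + 1) with hμdef
  have hμ : ∀ n, 0 < μ n := fun n => mul_pos hκ (eigenvalue_pos n.succ_pos)
  have hA : 0 ≤ 2 * C * (2 / t₀ ^ 2) := by positivity
  obtain ⟨η, hη, hAη⟩ := exists_pos_mul_le hA (show 0 < ε / 4 by positivity)
  -- `N` cuts off the tails of both eigenfunction expansions.
  obtain ⟨N, hN1, hN2⟩ : ∃ N : ℕ, ∑' n, 1 / eigenvalue (n + N + 1) ≤ η * κ ∧
      ∑' n, Real.exp (-(t₀ * κ * eigenvalue (n + N + 1))) ≤ ε / 4 := by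
    have h1 := tendsto_sum_nat_add fun n => 1 / eigenvalue (n + 1)
    have h2 := tendsto_sum_nat_add fun n => Real.exp (-(t₀ * κ * eigenvalue (n + 1)))
    obtain ⟨N, hN1, hN2⟩ := ((h1.eventually (gt_mem_nhds (mul_pos hη hκ))).and
      (h2.eventually (gt_mem_nhds (show 0 < ε / 4 by positivity)))).exists
    exact ⟨N, hN1.le, hN2.le⟩
  have hK : ∀ n, 0 ≤ quasimodeConst C t₀ (μ n) := fun n => by
    have := hμ n
    unfold quasimodeConst
    positivity
  obtain ⟨δ, hδ, hAδ⟩ := exists_pos_mul_le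
    (A := ∑ n ∈ Finset.range N, 1 / μ n * quasimodeConst C t₀ (μ n))
    (Finset.sum_nonneg fun n _ => mul_nonneg (one_div_nonneg.mpr (hμ n).le) (hK n))
    (show 0 < ε / 4 by positivity)
  have hmodes : ∀ᶠ L : ℕ in atTop, ∀ n < N, ∀ x : box L,
      |(green L w).mulVec (fun x : box L => mode (n + 1) ((x : ℤ) / L)) x
        - mode (n + 1) ((x : ℤ) / L) / μ n| ≤ δ := by
    have := (Finset.eventually_all (Finset.range N)).mpr fun n _ =>
      eventually_abs_green_mulVec_mode_sub_le hκ hw hres n hδ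
    exact this.mono fun L h n hn => h n (Finset.mem_range.mpr hn)
  filter_upwards [hmodes, hres (η / 4) (by positivity), hres (1 / κ) (by positivity),
    eventually_gt_atTop 0] with L hL1 hL2 hL3 hL t ht x y
  have hL' : (0 : ℝ) < L := by exact_mod_cast hL
  have hB : ∀ x y, |green L w x y| ≤ C / L := by
    intro x y
    rw [abs_of_nonneg (green_nonneg x y), le_div_iff₀ hL', mul_comm]
    refine (mul_green_le hL hw x y).trans ?_
    have h := (abs_le.mp (hL3 L (by lia) le_rfl)).2
    rw [Int.cast_natCast, div_self hL'.ne'] at h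
    have : C = 1 / κ + (1 + 1) / κ := by rw [hCdef]; ring
    linarith
  have hexp : ∀ x : box L, |(L : ℝ) * green L w x y - ∑ n ∈ Finset.range N,
      mode (n + 1) ((y : ℤ) / L) / μ n * mode (n + 1) ((x : ℤ) / L)| ≤ 2 * η := by
    intro x
    have h1 := abs_mul_green_sub_const_le hκ hL hw hL2 x y
    have h2 : |(L : ℝ) * green L (fun _ => κ.toNNReal) x y - ∑ n ∈ Finset.range N,
        mode (n + 1) ((y : ℤ) / L) / μ n * mode (n + 1) ((x : ℤ) / L)| ≤ η := by
      have h3 := abs_sub_sum_range_le (hasSum_greenFun (intCast_div_mem_Icc x)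
        (intCast_div_mem_Icc y)) summable_inv_eigenvalue (fun n => by
          rw [abs_mul, abs_of_pos (one_div_pos.mpr (eigenvalue_pos n.succ_pos))]
          exact mul_le_of_le_one_right (one_div_pos.mpr (eigenvalue_pos n.succ_pos)).le
            (abs_mode_mul_mode_le _ _ _)) N
      rw [mul_green_const hL (Real.toNNReal_pos.mpr hκ), Real.coe_toNNReal κ hκ.le]
      have h4 : ∑ n ∈ Finset.range N,
          mode (n + 1) ((y : ℤ) / L) / μ n * mode (n + 1) ((x : ℤ) / L)
          = (∑ n ∈ Finset.range N, 1 / eigenvalue (n + 1) *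
            (mode (n + 1) ((x : ℤ) / L) * mode (n + 1) ((y : ℤ) / L))) / κ := by
        rw [Finset.sum_div]
        refine Finset.sum_congr rfl fun n _ => ?_
        have := (eigenvalue_pos n.succ_pos).ne'
        simp only [hμdef]
        field_simp
      rw [h4, ← sub_div, abs_div, abs_of_pos hκ, div_le_iff₀ hκ]
      exact h3.trans hN1
    have := abs_sub_le ((L : ℝ) * green L w x y) (L * green L (fun _ => κ.toNNReal) x y)
      (∑ n ∈ Finset.range N, mode (n + 1) ((y : ℤ) / L) / μ n * mode (n + 1) ((x : ℤ) / L))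
    linarith
  have hmain := abs_exp_apply_sub_sum_le (isHermitian_scaledGenerator L w)
    (eigenvalues_scaledGenerator_pos hL hw) (green_mul_scaledGenerator hL hw) hC.le hL' hB
    (card_box_le L) ht₀ ht hδ.le (by positivity) hμ hL1 hexp x
  rw [← transition_eq_exp] at hmain
  have hsum : ∑ n ∈ Finset.range N, mode (n + 1) ((y : ℤ) / L) / μ n *
      (μ n * Real.exp (-(t * μ n)) * mode (n + 1) ((x : ℤ) / L))
      = ∑ n ∈ Finset.range N, Real.exp (-(t * κ * eigenvalue (n + 1))) *
        (mode (n + 1) ((x : ℤ) / L) * mode (n + 1) ((y : ℤ) / L)) := by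
    refine Finset.sum_congr rfl fun n _ => ?_
    have := (hμ n).ne'
    rw [show t * κ * eigenvalue (n + 1) = t * μ n by simp only [hμdef]; ring]
    field_simp
  have hcoef : (∑ n ∈ Finset.range N, |mode (n + 1) (((y : ℤ) : ℝ) / L) / μ n| *
      quasimodeConst C t₀ (μ n)) * δ ≤ ε / 4 := by
    refine le_trans (mul_le_mul_of_nonneg_right (Finset.sum_le_sum fun n _ => ?_) hδ.le) hAδ
    refine mul_le_mul_of_nonneg_right ?_ (hK n)
    rw [abs_div, abs_of_pos (hμ n)]
    exact div_le_div_of_nonneg_right (abs_mode_le _ _) (hμ n).le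
  have htail := abs_heatKernel_sub_sum_le hκ ht₀ ht N (((x : ℤ) : ℝ) / L) (((y : ℤ) : ℝ) / L)
  rw [hsum] at hmain
  rw [abs_sub_comm] at htail
  refine (abs_sub_le _ _ _).trans ((add_le_add hmain htail).trans ?_)
  linarith

/-! ### Extension of the kernel convergence to the interval -/

theorem abs_mode_sub_le (n : ℕ) (r r' : ℝ) :
    |mode (n + 1) r - mode (n + 1) r'| ≤ eigenvalue (n + 1) * |r - r'| := by
  have h1 : 1 ≤ ((n + 1 : ℕ) : ℝ) * Real.pi / 2 := by
    have := Real.pi_gt_three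
    have hn : (0 : ℝ) ≤ n := n.cast_nonneg
    push_cast
    nlinarith
  have h2 : |mode (n + 1) r - mode (n + 1) r'| ≤ ((n + 1 : ℕ) : ℝ) * Real.pi / 2 * |r - r'| := by
    have h := Real.abs_sin_sub_sin_le (((n + 1 : ℕ) : ℝ) * Real.pi / 2 * (r + 1))
      (((n + 1 : ℕ) : ℝ) * Real.pi / 2 * (r' + 1))
    rw [← mul_sub, add_sub_add_right_eq_sub, abs_mul,
      abs_of_pos (show 0 < ((n + 1 : ℕ) : ℝ) * Real.pi / 2 by linarith)] at h
    exact h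
  refine h2.trans (mul_le_mul_of_nonneg_right ?_ (abs_nonneg _))
  unfold eigenvalue
  nlinarith

theorem summable_exp_mul_eigenvalue (hκ : 0 < κ) {t : ℝ} (ht : 0 < t) :
    Summable fun n : ℕ => Real.exp (-(t * κ * eigenvalue (n + 1))) * eigenvalue (n + 1) := by
  refine Summable.of_nonneg_of_le (fun n => mul_nonneg (Real.exp_pos _).le
    (eigenvalue_pos n.succ_pos).le) (fun n => ?_)
    ((summable_exp hκ (half_pos ht)).mul_left (1 / (t / 2 * κ)))
  have h := mul_exp_neg_le (show 0 < t / 2 * κ by positivity) le_rfl (eigenvalue_pos n.succ_pos).le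
  have he : Real.exp (-(t * κ * eigenvalue (n + 1)))
      = Real.exp (-(t / 2 * κ * eigenvalue (n + 1))) *
        Real.exp (-(t / 2 * κ * eigenvalue (n + 1))) := by
    rw [← Real.exp_add]
    congr 1
    ring
  rw [he, mul_assoc, mul_comm, mul_comm (Real.exp _) (eigenvalue _)]
  exact mul_le_mul_of_nonneg_right h (Real.exp_pos _).le

theorem abs_heatKernel_sub_le (hκ : 0 < κ) {t₀ t : ℝ} (ht₀ : 0 < t₀) (ht : t₀ ≤ t)
    (r s r' s' : ℝ) :
    |heatKernel κ t r s - heatKernel κ t r' s'|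
      ≤ (∑' n : ℕ, Real.exp (-(t₀ * κ * eigenvalue (n + 1))) * eigenvalue (n + 1)) *
        (|r - r'| + |s - s'|) := by
  have ht' := ht₀.trans_le ht
  rw [heatKernel, heatKernel,
    ← (summable_heatKernel hκ ht' r s).tsum_sub (summable_heatKernel hκ ht' r' s'),
    ← Real.norm_eq_abs]
  refine tsum_of_norm_bounded
    ((summable_exp_mul_eigenvalue hκ ht₀).hasSum.mul_right _) fun n => ?_
  have h1 : |mode (n + 1) r * mode (n + 1) s - mode (n + 1) r' * mode (n + 1) s'|
      ≤ eigenvalue (n + 1) * (|r - r'| + |s - s'|) := by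
    have he : mode (n + 1) r * mode (n + 1) s - mode (n + 1) r' * mode (n + 1) s'
        = (mode (n + 1) r - mode (n + 1) r') * mode (n + 1) s
          + mode (n + 1) r' * (mode (n + 1) s - mode (n + 1) s') := by ring
    rw [he, mul_add]
    refine (abs_add_le _ _).trans (add_le_add ?_ ?_) <;> rw [abs_mul]
    · exact (mul_le_of_le_one_right (abs_nonneg _) (abs_mode_le _ _)).trans (abs_mode_sub_le n r r')
    · exact (mul_le_of_le_one_left (abs_nonneg _) (abs_mode_le _ _)).trans (abs_mode_sub_le n s s')
  rw [← mul_sub, Real.norm_eq_abs, abs_mul, Real.abs_exp]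
  exact (mul_le_mul (exp_eigenvalue_le hκ ht n) h1 (abs_nonneg _) (Real.exp_pos _).le).trans_eq
    (mul_assoc _ _ _).symm

theorem heatKernel_neg_one_left (κ t s : ℝ) : heatKernel κ t (-1) s = 0 := by
  simp [heatKernel, (mode_boundary _).1]

theorem heatKernel_neg_one_right (κ t r : ℝ) : heatKernel κ t r (-1) = 0 := by
  simp [heatKernel, (mode_boundary _).1]

/-- The integral kernel on `(-1,1)` of the rescaled semigroup of the walk. -/
noncomputable def walkKernel (L : ℕ) (w : ℤ → ℝ≥0) (t ξ ζ : ℝ) : ℝ :=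
  zeroExt (fun x => zeroExt (fun y => (L : ℝ) * transition L w ((L : ℝ) ^ 2 * t) x y) ⌊(L : ℝ) * ζ⌋)
    ⌊(L : ℝ) * ξ⌋

/-- For `ξ ∈ (-1,1)` the lattice point `⌊L ξ⌋` is in the box or equal to `-L`. -/
theorem floor_mem_box_or {L : ℕ} (hL : 0 < L) {ξ : ℝ} (hξ : ξ ∈ Set.Ioo (-1 : ℝ) 1) :
    (⌊(L : ℝ) * ξ⌋ ∈ box L ∨ ⌊(L : ℝ) * ξ⌋ = -(L : ℤ)) ∧ |ξ - (⌊(L : ℝ) * ξ⌋ : ℝ) / L| ≤ 1 / L := by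
  have hL' : (0 : ℝ) < L := by exact_mod_cast hL
  have h1 : -(L : ℤ) ≤ ⌊(L : ℝ) * ξ⌋ := by
    rw [Int.le_floor]
    push_cast
    nlinarith [hξ.1]
  have h2 : ⌊(L : ℝ) * ξ⌋ < L := by
    rw [Int.floor_lt]
    push_cast
    nlinarith [hξ.2]
  refine ⟨?_, ?_⟩
  · rcases h1.lt_or_eq with h | h
    · exact Or.inl (mem_box_iff.mpr ⟨h, h2⟩)
    · exact Or.inr h.symm
  · have h3 := Int.floor_le ((L : ℝ) * ξ)
    have h4 := Int.lt_floor_add_one ((L : ℝ) * ξ)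
    have he : ξ - (⌊(L : ℝ) * ξ⌋ : ℝ) / L = (L * ξ - ⌊(L : ℝ) * ξ⌋) / L := by field_simp
    rw [he, abs_div, abs_of_pos hL', abs_of_nonneg (by linarith)]
    exact div_le_div_of_nonneg_right (by linarith) hL'.le

theorem zeroExt_apply_of_mem {L : ℕ} (u : box L → ℝ) {z : ℤ} (hz : z ∈ box L) :
    zeroExt u z = u ⟨z, hz⟩ := dif_pos hz

theorem zeroExt_neg {L : ℕ} (u : box L → ℝ) : zeroExt u (-(L : ℤ)) = 0 :=
  dif_neg fun h => lt_irrefl _ (mem_box_iff.mp h).1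

/-- Uniform convergence of the kernel of the rescaled walk to the heat kernel. -/
theorem eventually_abs_walkKernel_sub_heatKernel_le (hκ : 0 < κ) (hw : ∀ z, 0 < w z)
    (hres : ResistanceConverges w κ) {t₀ : ℝ} (ht₀ : 0 < t₀) {ε : ℝ} (hε : 0 < ε) :
    ∀ᶠ L : ℕ in atTop, ∀ t : ℝ, t₀ ≤ t → ∀ ξ ∈ Set.Ioo (-1 : ℝ) 1, ∀ ζ ∈ Set.Ioo (-1 : ℝ) 1,
      |walkKernel L w t ξ ζ - heatKernel κ t ξ ζ| ≤ ε := by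
  set D := ∑' n : ℕ, Real.exp (-(t₀ * κ * eigenvalue (n + 1))) * eigenvalue (n + 1) with hD
  have hD0 : 0 ≤ D := tsum_nonneg fun n =>
    mul_nonneg (Real.exp_pos _).le (eigenvalue_pos n.succ_pos).le
  have hlim : Tendsto (fun L : ℕ => D * (1 / (L : ℝ) + 1 / L)) atTop (𝓝 0) := by
    have h := (tendsto_one_div_atTop_nhds_zero_nat (𝕜 := ℝ))
    simpa using (h.add h).const_mul D
  filter_upwards [eventually_abs_transition_sub_heatKernel_le hκ hw hres ht₀ (half_pos hε),
    hlim.eventually (gt_mem_nhds (half_pos hε)), eventually_gt_atTop 0]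
    with L h1 h2 hL t ht ξ hξ ζ hζ
  have hL' : (L : ℝ) ≠ 0 := by exact_mod_cast hL.ne'
  obtain ⟨hx, hξx⟩ := floor_mem_box_or hL hξ
  obtain ⟨hy, hζy⟩ := floor_mem_box_or hL hζ
  have hedge : ((-(L : ℤ) : ℤ) : ℝ) / L = -1 := by
    rw [Int.cast_neg, Int.cast_natCast, neg_div, div_self hL']
  have hgrid : |walkKernel L w t ξ ζ
      - heatKernel κ t ((⌊(L : ℝ) * ξ⌋ : ℝ) / L) ((⌊(L : ℝ) * ζ⌋ : ℝ) / L)| ≤ ε / 2 := by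
    unfold walkKernel
    rcases hx with hx | hx
    · rw [zeroExt_apply_of_mem _ hx]
      rcases hy with hy | hy
      · rw [zeroExt_apply_of_mem _ hy]
        exact h1 t ht ⟨_, hx⟩ ⟨_, hy⟩
      · rw [hy, zeroExt_neg, hedge, heatKernel_neg_one_right, sub_zero, abs_zero]
        exact (half_pos hε).le
    · rw [hx, zeroExt_neg, hedge, heatKernel_neg_one_left, sub_zero, abs_zero]
      exact (half_pos hε).le
  have hcont := abs_heatKernel_sub_le hκ ht₀ ht ξ ζ ((⌊(L : ℝ) * ξ⌋ : ℝ) / L)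
    ((⌊(L : ℝ) * ζ⌋ : ℝ) / L)
  have hcont' := hcont.trans (mul_le_mul_of_nonneg_left (add_le_add hξx hζy) hD0)
  rw [abs_sub_comm] at hcont'
  refine (abs_sub_le _ _ _).trans ((add_le_add hgrid hcont').trans ?_)
  linarith

end Kernel

/-! ### From kernels to densities and to operators on `L²(-1,1)` -/

section Operators

variable {L : ℕ} {w : ℤ → ℝ≥0} {κ : ℝ}

theorem mem_cell_iff (hL : 0 < L) {ζ : ℝ} {y : ℤ} : ζ ∈ cell L y ↔ ⌊(L : ℝ) * ζ⌋ = y := by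
  have hL' : (0 : ℝ) < L := by exact_mod_cast hL
  rw [Int.floor_eq_iff, cell, Set.mem_Ico, div_le_iff₀ hL', lt_div_iff₀ hL', mul_comm ζ]

theorem zeroExt_floor_eq_sum (hL : 0 < L) (u : box L → ℝ) (ζ : ℝ) :
    zeroExt u ⌊(L : ℝ) * ζ⌋ = ∑ y : box L, u y * (cell L y).indicator (fun _ => 1) ζ := by
  by_cases h : ⌊(L : ℝ) * ζ⌋ ∈ box L
  · rw [zeroExt_apply_of_mem u h, Finset.sum_eq_single ⟨_, h⟩]
    · rw [Set.indicator_of_mem ((mem_cell_iff hL).mpr rfl), mul_one]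
    · intro y _ hy
      rw [Set.indicator_of_notMem, mul_zero]
      exact fun hm => hy (Subtype.ext ((mem_cell_iff hL).mp hm).symm)
    · exact fun hn => absurd (Finset.mem_univ _) hn
  · rw [zeroExt, dif_neg h]
    refine (Finset.sum_eq_zero fun y _ => ?_).symm
    rw [Set.indicator_of_notMem, mul_zero]
    exact fun hm => h (by rw [(mem_cell_iff hL).mp hm]; exact y.2)

theorem integrable_zeroExt_floor_mul (hL : 0 < L) (u : box L → ℝ) {μ : Measure ℝ} {f : ℝ → ℝ}
    (hf : Integrable f μ) : Integrable (fun ζ => zeroExt u ⌊(L : ℝ) * ζ⌋ * f ζ) μ := by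
  simp only [zeroExt_floor_eq_sum hL, Finset.sum_mul, mul_assoc, ← Set.indicator_mul_left, one_mul]
  exact integrable_finsetSum _ fun y _ => (hf.indicator (measurableSet_cell L y)).const_mul _

theorem integral_zeroExt_floor_mul (hL : 0 < L) (u : box L → ℝ) {μ : Measure ℝ} {f : ℝ → ℝ}
    (hf : Integrable f μ) :
    ∫ ζ, zeroExt u ⌊(L : ℝ) * ζ⌋ * f ζ ∂μ = ∑ y : box L, u y * ∫ ζ in cell L y, f ζ ∂μ := by
  simp only [zeroExt_floor_eq_sum hL, Finset.sum_mul, mul_assoc, ← Set.indicator_mul_left, one_mul]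
  rw [integral_finsetSum _ fun (y : box L) _ => (hf.indicator (measurableSet_cell L y)).const_mul _]
  exact Finset.sum_congr rfl fun y _ => by
    rw [integral_const_mul, integral_indicator (measurableSet_cell L y)]

theorem integrable_walkKernel_mul (hL : 0 < L) (t ξ : ℝ) {μ : Measure ℝ} {f : ℝ → ℝ}
    (hf : Integrable f μ) : Integrable (fun ζ => walkKernel L w t ξ ζ * f ζ) μ := by
  unfold walkKernel
  by_cases h : ⌊(L : ℝ) * ξ⌋ ∈ box L
  · simp only [zeroExt_apply_of_mem _ h]
    exact integrable_zeroExt_floor_mul hL _ hf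
  · simp only [zeroExt, dif_neg h, zero_mul]
    exact integrable_zero _ _ _

/-- The semigroup of the walk acting on cell averages is integration against `walkKernel`. -/
theorem zeroExt_transition_mulVec (hL : 0 < L) (t ξ : ℝ) {μ : Measure ℝ} {f : ℝ → ℝ}
    (hf : Integrable f μ) :
    zeroExt ((transition L w ((L : ℝ) ^ 2 * t)).mulVec fun y => L * ∫ ζ in cell L y, f ζ ∂μ)
      ⌊(L : ℝ) * ξ⌋ = ∫ ζ, walkKernel L w t ξ ζ * f ζ ∂μ := by
  unfold walkKernel
  by_cases h : ⌊(L : ℝ) * ξ⌋ ∈ box L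
  · simp only [zeroExt_apply_of_mem _ h]
    rw [integral_zeroExt_floor_mul hL _ hf]
    simp only [Matrix.mulVec, dotProduct]
    refine Finset.sum_congr rfl fun y _ => ?_
    ring
  · simp only [zeroExt, dif_neg h, zero_mul, integral_zero]

theorem continuous_heatKernel (hκ : 0 < κ) {t : ℝ} (ht : 0 < t) (ξ : ℝ) :
    Continuous (heatKernel κ t ξ) := by
  refine continuous_tsum (fun n => ?_) (summable_exp hκ ht) fun n ζ => ?_
  · exact continuous_const.mul (continuous_const.mul (continuous_mode _))
  · rw [norm_mul, Real.norm_of_nonneg (Real.exp_pos _).le]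
    exact mul_le_of_le_one_right (Real.exp_pos _).le (abs_mode_mul_mode_le _ _ _)

theorem integrable_heatKernel (hκ : 0 < κ) {t : ℝ} (ht : 0 < t) (ξ : ℝ) (μ : Measure ℝ)
    [IsFiniteMeasure μ] : Integrable (heatKernel κ t ξ) μ := by
  refine Integrable.of_bound (continuous_heatKernel hκ ht ξ).aestronglyMeasurable
    (∑' n, Real.exp (-(t * κ * eigenvalue (n + 1)))) (Eventually.of_forall fun ζ => ?_)
  simpa using abs_heatKernel_sub_sum_le hκ ht le_rfl 0 ξ ζ

theorem densityConvergence_of_resistanceConverges (hκ : 0 < κ) (hw : ∀ z, 0 < w z)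
    (hres : ResistanceConverges w κ) : DensityConvergence w κ := by
  intro t₀ ht₀ ε hε
  filter_upwards [eventually_abs_walkKernel_sub_heatKernel_le hκ hw hres ht₀ hε,
    eventually_gt_atTop 0] with L h hL t ht ξ hξ μ₀ hμ₀ hsupp
  have hone : Integrable (fun _ : ℝ => (1 : ℝ)) μ₀ := integrable_const 1
  have hdisc : discretize L μ₀ = fun y : box L => L * ∫ _ in cell L y, (1 : ℝ) ∂μ₀ := by
    ext y
    simp [discretize]
  have hint := integrable_walkKernel_mul (w := w) hL t ξ hone
  rw [hdisc, zeroExt_transition_mulVec hL t ξ hone]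
  simp only [mul_one] at hint ⊢
  rw [← integral_sub hint (integrable_heatKernel hκ (ht₀.trans_le ht) ξ μ₀), ← Real.norm_eq_abs]
  refine norm_integral_le_of_norm_le_const (C := ε) ?_
  filter_upwards [measure_eq_zero_iff_ae_notMem.mp hsupp] with ζ hζ
  exact h t ht ξ hξ ζ (by simpa only [Set.notMem_compl_iff] using hζ)

theorem integrable_coeFn (f : L2I) : Integrable f intervalMeasure :=
  (Lp.memLp f).integrable one_le_two

theorem intervalMeasure_univ : intervalMeasure Set.univ = 2 := by
  norm_num [intervalMeasure]

theorem integral_norm_le (f : L2I) : ∫ ζ, ‖f ζ‖ ∂intervalMeasure ≤ 2 * ‖f‖ := by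
  have h := eLpNorm_le_eLpNorm_mul_rpow_measure_univ (μ := intervalMeasure) (one_le_two (α := ℝ≥0∞))
    (Lp.aestronglyMeasurable f)
  rw [intervalMeasure_univ] at h
  have h2 : (2 : ℝ≥0∞) ^ (1 / (1 : ℝ≥0∞).toReal - 1 / (2 : ℝ≥0∞).toReal) ≤ 2 := by
    conv_rhs => rw [← ENNReal.rpow_one 2]
    exact ENNReal.rpow_le_rpow_of_exponent_le one_le_two (by norm_num)
  have h3 := h.trans (mul_le_mul_right h2 _)
  rw [integral_norm_eq_lintegral_enorm (Lp.aestronglyMeasurable f),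
    ← eLpNorm_one_eq_lintegral_enorm,
    Lp.norm_def, mul_comm, ← ENNReal.toReal_ofNat, ← ENNReal.toReal_mul]
  exact ENNReal.toReal_mono (ENNReal.mul_ne_top (Lp.eLpNorm_ne_top f) ENNReal.ofNat_ne_top) h3

theorem ae_mem_Ioo : ∀ᵐ ζ ∂intervalMeasure, ζ ∈ Set.Ioo (-1 : ℝ) 1 :=
  ae_restrict_mem measurableSet_Ioo

/-- An integral operator with a small kernel has small operator norm. -/
theorem norm_le_of_kernel {f g : L2I} {k : ℝ → ℝ → ℝ} {ε : ℝ} (hε : 0 ≤ ε)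
    (hg : ∀ᵐ ξ ∂intervalMeasure, g ξ = ∫ ζ, k ξ ζ * f ζ ∂intervalMeasure)
    (hk : ∀ ξ ∈ Set.Ioo (-1 : ℝ) 1, ∀ ζ ∈ Set.Ioo (-1 : ℝ) 1, |k ξ ζ| ≤ ε) :
    ‖g‖ ≤ 4 * ε * ‖f‖ := by
  have hpt : ∀ᵐ ξ ∂intervalMeasure, ‖g ξ‖ ≤ ε * (2 * ‖f‖) := by
    filter_upwards [hg, ae_mem_Ioo] with ξ h hξ
    rw [h]
    calc ‖∫ ζ, k ξ ζ * f ζ ∂intervalMeasure‖ ≤ ∫ ζ, ε * ‖f ζ‖ ∂intervalMeasure := by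
          refine norm_integral_le_of_norm_le ((integrable_coeFn f).norm.const_mul ε) ?_
          filter_upwards [ae_mem_Ioo] with ζ hζ
          rw [norm_mul]
          exact mul_le_mul_of_nonneg_right (hk ξ hξ ζ hζ) (norm_nonneg _)
      _ ≤ ε * (2 * ‖f‖) := by
          rw [integral_const_mul]
          exact mul_le_mul_of_nonneg_left (integral_norm_le f) hε
  have hnn : 0 ≤ ε * (2 * ‖f‖) := by positivity
  have h := Lp.norm_le_of_ae_bound hnn hpt
  have h2 : (measureUnivNNReal intervalMeasure : ℝ) = 2 := by
    change (intervalMeasure Set.univ).toReal = 2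
    rw [intervalMeasure_univ]
    rfl
  have h3 : (2 : ℝ) ^ ((2 : ℝ≥0∞).toReal)⁻¹ ≤ 2 := by
    conv_rhs => rw [← Real.rpow_one 2]
    exact Real.rpow_le_rpow_of_exponent_le (by norm_num) (by norm_num)
  rw [h2] at h
  refine h.trans ((mul_le_mul_of_nonneg_right h3 hnn).trans_eq ?_)
  ring

theorem embed_ae_eq (hL : 0 < L) (u : box L → ℝ) :
    ∀ᵐ ξ ∂intervalMeasure, embed L u ξ = zeroExt u ⌊(L : ℝ) * ξ⌋ := by
  have hsum : embed L u = ∑ x : box L, u x • cellInd L x := by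
    simp [embed]
  have h1 := Lp.coeFn_finsetSum Finset.univ fun x : box L => u x • cellInd L x
  have h2 : ∀ᵐ ξ ∂intervalMeasure, ∀ x : box L,
      (u x • cellInd L x : L2I) ξ = u x * (cell L x).indicator (fun _ => 1) ξ := by
    refine ae_all_iff.mpr fun x => ?_
    filter_upwards [Lp.coeFn_smul (u x) (cellInd L x),
      indicatorConstLp_coeFn (p := 2) (hs := measurableSet_cell L x)
        (hμs := measure_ne_top intervalMeasure (cell L x)) (c := (1 : ℝ))] with ξ h3 h4
    rw [h3, Pi.smul_apply, smul_eq_mul, cellInd, h4]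
  rw [hsum]
  filter_upwards [h1, h2] with ξ h3 h4
  rw [h3, zeroExt_floor_eq_sum hL, Finset.sum_apply]
  exact Finset.sum_congr rfl fun x _ => h4 x

theorem walkSemigroup_ae_eq (hL : 0 < L) (t : ℝ) (f : L2I) :
    ∀ᵐ ξ ∂intervalMeasure,
      walkSemigroup L w t f ξ = ∫ ζ, walkKernel L w t ξ ζ * f ζ ∂intervalMeasure := by
  filter_upwards [embed_ae_eq hL ((transition L w ((L : ℝ) ^ 2 * t)).mulVec (average L f))]
    with ξ hξ
  rw [← zeroExt_transition_mulVec hL t ξ (integrable_coeFn f)]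
  have havg : average L f = fun y : box L => L * ∫ r in cell L y, f r ∂intervalMeasure :=
    funext fun y => average_apply L f y
  rw [← havg]
  exact hξ

/-- The partial sums of the heat semigroup are integral operators, with the partial sums of the heat
kernel as kernels. -/
theorem heatPartialSum_ae_eq (κ t : ℝ) (N : ℕ) (f : L2I) :
    ∀ᵐ ξ ∂intervalMeasure,
      (∑ n ∈ Finset.range N, Real.exp (-(t * κ * eigenvalue (n + 1))) •
        InnerProductSpace.rankOne ℝ (modeL2 (n + 1)) (modeL2 (n + 1))) f ξ
      = ∫ ζ, (∑ n ∈ Finset.range N, Real.exp (-(t * κ * eigenvalue (n + 1))) *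
        (mode (n + 1) ξ * mode (n + 1) ζ)) * f ζ ∂intervalMeasure := by
  have hint : ∀ n, Integrable (fun ζ => mode n ζ * f ζ) intervalMeasure := fun n =>
    (integrable_coeFn f).bdd_mul (c := 1) (continuous_mode n).aestronglyMeasurable
      (Eventually.of_forall fun ζ => abs_mode_le n ζ)
  have hinner : ∀ n, inner ℝ (modeL2 n) f = ∫ ζ, mode n ζ * f ζ ∂intervalMeasure := by
    intro n
    rw [L2.inner_def]
    refine integral_congr_ae ?_
    filter_upwards [(memLp_mode n).coeFn_toLp] with ζ hζ
    simp only [modeL2, hζ]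
    simp [mul_comm]
  set c : ℕ → ℝ := fun n =>
    Real.exp (-(t * κ * eigenvalue (n + 1))) * ∫ ζ, mode (n + 1) ζ * f ζ ∂intervalMeasure with hc
  have hsum : (∑ n ∈ Finset.range N, Real.exp (-(t * κ * eigenvalue (n + 1))) •
      InnerProductSpace.rankOne ℝ (modeL2 (n + 1)) (modeL2 (n + 1))) f
      = ∑ n ∈ Finset.range N, c n • modeL2 (n + 1) := by
    rw [sum_apply]
    refine Finset.sum_congr rfl fun n _ => ?_
    rw [smul_apply, InnerProductSpace.rankOne_apply, hinner, smul_smul]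
  have h1 := Lp.coeFn_finsetSum (Finset.range N) fun n => c n • modeL2 (n + 1)
  have h2 : ∀ᵐ ξ ∂intervalMeasure, ∀ n : ℕ,
      (c n • modeL2 (n + 1) : L2I) ξ = c n * mode (n + 1) ξ := by
    refine ae_all_iff.mpr fun n => ?_
    filter_upwards [Lp.coeFn_smul (c n) (modeL2 (n + 1)), (memLp_mode (n + 1)).coeFn_toLp]
      with ξ h3 h4
    rw [h3, Pi.smul_apply, smul_eq_mul, modeL2, h4]
  rw [hsum]
  filter_upwards [h1, h2] with ξ h3 h4
  rw [h3, Finset.sum_apply]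
  have hterm : ∀ n ζ,
      Real.exp (-(t * κ * eigenvalue (n + 1))) * (mode (n + 1) ξ * mode (n + 1) ζ) * f ζ
      = Real.exp (-(t * κ * eigenvalue (n + 1))) * mode (n + 1) ξ * (mode (n + 1) ζ * f ζ) :=
    fun n ζ => by ring
  simp only [Finset.sum_mul, hterm]
  rw [integral_finsetSum _ fun n _ => (hint (n + 1)).const_mul _]
  refine Finset.sum_congr rfl fun n _ => ?_
  rw [h4 n, integral_const_mul, hc]
  ring

theorem normConvergence_of_resistanceConverges (hκ : 0 < κ) (hw : ∀ z, 0 < w z)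
    (hres : ResistanceConverges w κ) : NormConvergence w κ := by
  intro t₀ ht₀
  rw [Metric.tendstoUniformlyOn_iff]
  intro ε hε
  filter_upwards [eventually_abs_walkKernel_sub_heatKernel_le hκ hw hres ht₀
    (show 0 < ε / 8 by positivity), eventually_gt_atTop 0] with L h hL t ht
  have ht' : 0 < t := ht₀.trans_le ht
  set S : ℕ → L2I →L[ℝ] L2I := fun N => ∑ n ∈ Finset.range N,
    Real.exp (-(t * κ * eigenvalue (n + 1))) •
      InnerProductSpace.rankOne ℝ (modeL2 (n + 1)) (modeL2 (n + 1)) with hS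
  have hSlim : Tendsto S atTop (𝓝 (heatSemigroup κ t)) :=
    (summable_heatSemigroup hκ ht').hasSum.tendsto_sum_nat
  set τ : ℕ → ℝ := fun N => ∑' n, Real.exp (-(t * κ * eigenvalue (n + N + 1))) with hτ
  have hτlim : Tendsto τ atTop (𝓝 0) :=
    tendsto_sum_nat_add fun n => Real.exp (-(t * κ * eigenvalue (n + 1)))
  have hτ0 : ∀ N, 0 ≤ τ N := fun N => tsum_nonneg fun n => (Real.exp_pos _).le
  have hbound : ∀ N, ‖S N - walkSemigroup L w t‖ ≤ 4 * (τ N + ε / 8) := by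
    intro N
    have hnn : 0 ≤ τ N + ε / 8 := add_nonneg (hτ0 N) (by positivity)
    refine ContinuousLinearMap.opNorm_le_bound _ (by positivity) fun f => ?_
    refine norm_le_of_kernel (k := fun ξ ζ => (∑ n ∈ Finset.range N,
      Real.exp (-(t * κ * eigenvalue (n + 1))) * (mode (n + 1) ξ * mode (n + 1) ζ))
        - walkKernel L w t ξ ζ) hnn ?_ fun ξ hξ ζ hζ => ?_
    · filter_upwards [heatPartialSum_ae_eq κ t N f, walkSemigroup_ae_eq (w := w) hL t f,
        Lp.coeFn_sub (S N f) (walkSemigroup L w t f)] with ξ h1 h2 h3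
      rw [sub_apply, h3, Pi.sub_apply, h1, h2, ← integral_sub]
      · simp only [sub_mul]
      · refine (integrable_coeFn f).bdd_mul (c := ∑ n ∈ Finset.range N,
          Real.exp (-(t * κ * eigenvalue (n + 1)))) ?_ (Eventually.of_forall fun ζ => ?_)
        · exact (continuous_finsetSum _ fun n _ => continuous_const.mul
            (continuous_const.mul (continuous_mode _))).aestronglyMeasurable
        · refine (norm_sum_le _ _).trans (Finset.sum_le_sum fun n _ => ?_)
          rw [norm_mul, Real.norm_of_nonneg (Real.exp_pos _).le]
          exact mul_le_of_le_one_right (Real.exp_pos _).le (abs_mode_mul_mode_le _ _ _)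
      · exact integrable_walkKernel_mul hL t ξ (integrable_coeFn f)
    · have h1 := abs_heatKernel_sub_sum_le hκ ht' le_rfl N ξ ζ
      have h2 := h t ht ξ hξ ζ hζ
      rw [abs_sub_comm] at h1 h2
      exact (abs_sub_le _ _ _).trans (add_le_add h1 h2)
  have hlim : ‖heatSemigroup κ t - walkSemigroup L w t‖ ≤ 4 * (0 + ε / 8) :=
    le_of_tendsto_of_tendsto' (hSlim.sub_const _).norm ((hτlim.add_const _).const_mul 4) hbound
  rw [dist_eq_norm]
  linarith

theorem convergesToBrownianMotion_of_resistanceConverges (hκ : 0 < κ) (hw : ∀ z, 0 < w z)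
    (hres : ResistanceConverges w κ) : ConvergesToBrownianMotion w κ :=
  ⟨normConvergence_of_resistanceConverges hκ hw hres,
    densityConvergence_of_resistanceConverges hκ hw hres⟩

end Operators

/-! ### Convergence of the resistances in a stationary environment -/

section Environment

/-- Convergence of averages makes the linear approximation uniform on an initial segment. -/
theorem eventually_forall_le_abs_sub_le {a : ℕ → ℝ} {c : ℝ}
    (h : Tendsto (fun n : ℕ => a n / n) atTop (𝓝 c)) {ε : ℝ} (hε : 0 < ε) :
    ∀ᶠ L : ℕ in atTop, ∀ n ≤ L, |a n - n * c| ≤ ε * L := by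
  obtain ⟨N, hN⟩ := eventually_atTop.mp (Metric.tendsto_nhds.mp h ε hε)
  set M := ∑ n ∈ Finset.range (N + 1), |a n - n * c| with hM
  filter_upwards [eventually_ge_atTop ⌈M / ε⌉₊] with L hL n hn
  rcases lt_or_ge N n with h1 | h1
  · have hn0 : (0 : ℝ) < n := by exact_mod_cast (Nat.zero_le N).trans_lt h1
    have h2 := (hN n h1.le).le
    rw [Real.dist_eq, show a n / n - c = (a n - n * c) / n by field_simp, abs_div,
      abs_of_pos hn0, div_le_iff₀ hn0] at h2
    exact h2.trans (mul_le_mul_of_nonneg_left (by exact_mod_cast hn) hε.le)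
  · have h2 : |a n - n * c| ≤ M := Finset.single_le_sum (f := fun n : ℕ => |a n - n * c|)
      (fun _ _ => abs_nonneg _) (Finset.mem_range.mpr (Nat.lt_succ_of_le h1))
    have h3 : M / ε ≤ L := (Nat.le_ceil _).trans (by exact_mod_cast hL)
    rw [div_le_iff₀ hε] at h3
    linarith

variable {w : ℤ → ℝ≥0}

theorem resistance_neg_add (L m : ℕ) (hm : m ≤ L) :
    resistance L w (-(m : ℤ)) + ∑ k ∈ Finset.range m, (w (-(k : ℤ) - 1) : ℝ)⁻¹
      = resistance L w 0 := by
  induction m with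
  | zero => simp
  | succ m ih =>
    rw [← ih (by lia), Finset.sum_range_succ]
    have h := resistance_succ (L := L) (w := w) (x := -(m : ℤ) - 1) (by lia)
    rw [sub_add_cancel] at h
    rw [h, show -((m + 1 : ℕ) : ℤ) = -(m : ℤ) - 1 by push_cast; ring]
    ring

theorem resistance_zero (L : ℕ) :
    resistance L w 0 = ∑ k ∈ Finset.range L, (w (-(k : ℤ) - 1) : ℝ)⁻¹ := by
  rw [← resistance_neg_add L L le_rfl, resistance_left, zero_add]

theorem resistance_natCast (L m : ℕ) :
    resistance L w m = resistance L w 0 + ∑ k ∈ Finset.range m, (w (k : ℤ) : ℝ)⁻¹ := by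
  induction m with
  | zero => simp
  | succ m ih =>
    rw [Nat.cast_succ, resistance_succ (by lia), ih, Finset.sum_range_succ, add_assoc]

theorem resistanceConverges_of_tendsto {κ : ℝ}
    (hfwd : Tendsto (fun n : ℕ => (∑ k ∈ Finset.range n, (w (k : ℤ) : ℝ)⁻¹) / n) atTop (𝓝 κ⁻¹))
    (hbwd : Tendsto (fun n : ℕ => (∑ k ∈ Finset.range n, (w (-(k : ℤ) - 1) : ℝ)⁻¹) / n) atTop
      (𝓝 κ⁻¹)) : ResistanceConverges w κ := by
  intro ε hε
  filter_upwards [eventually_forall_le_abs_sub_le hfwd (half_pos hε),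
    eventually_forall_le_abs_sub_le hbwd (half_pos hε), eventually_gt_atTop 0]
    with L h1 h2 hL x hx1 hx2
  have hL' : (0 : ℝ) < L := by exact_mod_cast hL
  have he : resistance L w x / L - ((x : ℝ) / L + 1) / κ
      = (resistance L w x - (x + L) * κ⁻¹) / L := by
    rw [div_eq_mul_inv _ κ]
    field_simp
  rw [he, abs_div, abs_of_pos hL', div_le_iff₀ hL']
  have hz := h2 L le_rfl
  rw [← resistance_zero] at hz
  rcases le_total 0 x with h0 | h0
  · obtain ⟨m, rfl⟩ := Int.eq_ofNat_of_zero_le h0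
    have hm := h1 m (by lia)
    rw [resistance_natCast, Int.cast_natCast]
    have := abs_add_le (resistance L w 0 - L * κ⁻¹)
      (∑ k ∈ Finset.range m, (w (k : ℤ) : ℝ)⁻¹ - m * κ⁻¹)
    calc _ = |(resistance L w 0 - L * κ⁻¹)
          + (∑ k ∈ Finset.range m, (w (k : ℤ) : ℝ)⁻¹ - m * κ⁻¹)| := by congr 1; ring
      _ ≤ ε * L := by linarith
  · obtain ⟨m, hm⟩ := Int.eq_ofNat_of_zero_le (neg_nonneg.mpr h0)
    obtain rfl : x = -(m : ℤ) := by lia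
    have hmL : m ≤ L := by lia
    have hm' := h2 m hmL
    have hr := resistance_neg_add (w := w) L m hmL
    have := abs_sub (resistance L w 0 - L * κ⁻¹)
      (∑ k ∈ Finset.range m, (w (-(k : ℤ) - 1) : ℝ)⁻¹ - m * κ⁻¹)
    calc _ = |(resistance L w 0 - L * κ⁻¹)
          - (∑ k ∈ Finset.range m, (w (-(k : ℤ) - 1) : ℝ)⁻¹ - m * κ⁻¹)| := by
            rw [← hr]; congr 1; push_cast; ring
      _ ≤ ε * L := by linarith

/-- The shift `(T w)_z = w_{z+1}` on environments. -/
def shiftEquiv : (ℤ → ℝ≥0) ≃ᵐ (ℤ → ℝ≥0) where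
  toFun v z := v (z + 1)
  invFun v z := v (z - 1)
  left_inv v := by simp
  right_inv v := by simp
  measurable_toFun := measurable_pi_iff.mpr fun z => measurable_pi_apply (z + 1)
  measurable_invFun := measurable_pi_iff.mpr fun z => measurable_pi_apply (z - 1)

theorem shiftEquiv_iterate (k : ℕ) (v : ℤ → ℝ≥0) (z : ℤ) : shiftEquiv^[k] v z = v (z + k) := by
  induction k generalizing v with
  | zero => simp
  | succ k ih =>
    rw [Function.iterate_succ_apply, ih]
    change v (z + k + 1) = _
    push_cast
    ring_nf

theorem shiftEquiv_symm_iterate (k : ℕ) (v : ℤ → ℝ≥0) (z : ℤ) :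
    shiftEquiv.symm^[k] v z = v (z - k) := by
  induction k generalizing v with
  | zero => simp
  | succ k ih =>
    rw [Function.iterate_succ_apply, ih]
    change v (z - k - 1) = _
    push_cast
    ring_nf

theorem toReal_inv_coe (a : ℝ≥0) : ((a : ℝ≥0∞)⁻¹).toReal = (a : ℝ)⁻¹ := by
  rw [ENNReal.toReal_inv, ENNReal.coe_toReal]

/-- Almost every environment has positive rates and converging resistances. -/
theorem ae_pos_and_resistanceConverges {Ω : Type*} [MeasurableSpace Ω] {P : Measure Ω}
    [IsProbabilityMeasure P] {w : ℤ → Ω → ℝ≥0} (hmeas : ∀ z, Measurable (w z))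
    (hstat : IsStationary P w) {κ : ℝ} (hκ : 0 < κ)
    (hsum : ∀ᵐ ω ∂P, Tendsto
      (fun x : ℕ => (∑ z ∈ Finset.range x, ((w (z : ℤ) ω : ℝ≥0∞))⁻¹) / (x : ℝ≥0∞))
      atTop (𝓝 (ENNReal.ofReal κ)⁻¹)) :
    ∀ᵐ ω ∂P, (∀ z, 0 < w z ω) ∧ ResistanceConverges (fun z => w z ω) κ := by
  set W : Ω → ℤ → ℝ≥0 := fun ω z => w z ω with hW
  have hWm : Measurable W := measurable_pi_iff.mpr hmeas
  have hT : MeasurePreserving shiftEquiv (P.map W) (P.map W) := by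
    refine ⟨shiftEquiv.measurable, ?_⟩
    rw [Measure.map_map shiftEquiv.measurable hWm]
    exact (hstat 1).map_eq
  have := Measure.isProbabilityMeasure_map (μ := P) hWm.aemeasurable
  set f : (ℤ → ℝ≥0) → ℝ≥0∞ := fun v => (v 0 : ℝ≥0∞)⁻¹ with hf
  have hfm : Measurable f := (measurable_pi_apply 0).coe_nnreal_ennreal.inv
  have hfwd : ∀ n v, birkhoffSum shiftEquiv f n v = ∑ z ∈ Finset.range n, (v (z : ℤ) : ℝ≥0∞)⁻¹ := by
    intro n v
    simp [birkhoffSum, hf, shiftEquiv_iterate]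
  have hlim : ∀ᵐ v ∂(P.map W), Tendsto (fun n : ℕ => birkhoffSum shiftEquiv f n v / n) atTop
      (𝓝 (ENNReal.ofReal κ)⁻¹) := by
    refine (ae_map_iff hWm.aemeasurable (measurableSet_tendsto _ fun n =>
      (measurable_birkhoffSum shiftEquiv.measurable hfm n).div_const _)).mpr ?_
    simpa only [hfwd] using hsum
  have hc : (ENNReal.ofReal κ)⁻¹ ≠ ∞ := ENNReal.inv_ne_top.mpr (ENNReal.ofReal_pos.mpr hκ).ne'
  have hcr : ((ENNReal.ofReal κ)⁻¹).toReal = κ⁻¹ := by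
    rw [ENNReal.toReal_inv, ENNReal.toReal_ofReal hκ.le]
  obtain ⟨hfin, h1, h2⟩ := ae_tendsto_birkhoffSum_symm shiftEquiv hT hfm hc hlim
  rw [hcr] at h1 h2
  have hTs := hT.symm shiftEquiv
  have hpos : ∀ᵐ v ∂(P.map W), ∀ z, 0 < v z := by
    refine ae_all_iff.mpr fun z => ?_
    have hz : ∀ v : ℤ → ℝ≥0, f v ≠ ∞ → 0 < v 0 := fun v hv =>
      pos_iff_ne_zero.mpr fun h0 => hv (by simp [hf, h0])
    obtain ⟨k, rfl | rfl⟩ := z.eq_nat_or_neg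
    · filter_upwards [(hT.iterate k).quasiMeasurePreserving.ae hfin] with v hv
      simpa [shiftEquiv_iterate] using hz _ hv
    · filter_upwards [(hTs.iterate k).quasiMeasurePreserving.ae hfin] with v hv
      simpa [shiftEquiv_symm_iterate] using hz _ hv
  have hall : ∀ᵐ v ∂(P.map W), (∀ z, 0 < v z) ∧ ResistanceConverges v κ := by
    filter_upwards [hpos, h1, hTs.quasiMeasurePreserving.ae h2] with v hv h3 h4
    refine ⟨hv, resistanceConverges_of_tendsto ?_ ?_⟩
    · simpa [birkhoffSum, hf, shiftEquiv_iterate, toReal_inv_coe] using h3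
    · refine h4.congr fun n => ?_
      simp only [birkhoffSum, hf, shiftEquiv_symm_iterate, toReal_inv_coe]
      congr 1
      refine Finset.sum_congr rfl fun k _ => ?_
      change ((v (0 - (k : ℤ) - 1) : ℝ≥0) : ℝ)⁻¹ = _
      rw [zero_sub]
  exact ae_of_ae_map hWm.aemeasurable hall

end Environment

end RandomConductance

theorem theorem1 {Ω : Type*} [MeasurableSpace Ω] (P : Measure Ω) [IsProbabilityMeasure P]
    (w : ℤ → Ω → ℝ≥0) (hmeas : ∀ z, Measurable (w z))
    (hstat : RandomConductance.IsStationary P w)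
    (κ : ℝ) (hκ : 0 < κ)
    (hsum : ∀ᵐ ω ∂P, Tendsto
      (fun x : ℕ => (∑ z ∈ Finset.range x, ((w (z : ℤ) ω : ℝ≥0∞))⁻¹) / (x : ℝ≥0∞))
      atTop (𝓝 (ENNReal.ofReal κ)⁻¹)) :
    ∀ᵐ ω ∂P, RandomConductance.ConvergesToBrownianMotion (fun z => w z ω) κ := by
  filter_upwards [RandomConductance.ae_pos_and_resistanceConverges hmeas hstat hκ hsum]
    with ω ⟨hpos, hres⟩
  exact RandomConductance.convergesToBrownianMotion_of_resistanceConverges hκ hpos hres
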